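/- **Conventions.** Let $R$ be an associative ring with unit and $n\ge 1$ an integer. $R$-modules are unital left $R$-modules, and $R^{op}$-modules are right $R$-modules. Let $C={}_RC_R$ be a semidualizing $(R,R)$-bimodule, that is: $C$ has a resolution by finitely generated projective modules both as a left and as a right $R$-module; the homothety maps $R\to\operatorname{Hom}_{R^{op}}(C,C)$, $s\mapsto(c\mapsto sc)$, and $R\to\operatorname{Hom}_R(C,C)$, $r\mapsto(c\mapsto cr)$, are bijective; and $\operatorname{Ext}^i_R(C,C)=0=\operatorname{Ext}^i_{R^{op}}(C,C)$ for all $i\ge1$. It is *faithfully semidualizing* if moreover, for every left module $N$ and every right module $M$, $\operatorname{Hom}_R(C,N)=0$ implies $N=0$, and $\operatorname{Hom}_{R^{op}}(C,M)=0$ implies $M=0$. A left $R$-module $M$ is *finitely $n$-presented* if there is an exact sequence $F_n\to\cdots\to F_1\to F_0\to M\to0$ with all $F_i$ finitely generated free. $R$ is *$n$-coherent* if every finitely $n$-presented left $R$-module is finitely $(n+1)$-presented. A left $R$-module $X$ is *$fp_n$-injective* if for every monomorphism $K\to L$ of finitely $n$-presented left $R$-modules, $\operatorname{Hom}_R(L,X)\to\operatorname{Hom}_R(K,X)$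 is surjective. A right $R$-module $Y$ is *$fp_n$-flat* if for every such $K\to L$ the map $Y\otimes_RK\to Y\otimes_RL$ is injective. Put $$Cfp_nI(R)=\{\operatorname{Hom}_R(C,X): X \text{ an } fp_n\text{-injective left } R\text{-module}\},$$ $$Cfp_nF(R^{op})=\{Y\otimes_RC: Y \text{ an } fp_n\text{-flat right } R\text{-module}\}$$ (up to isomorphism), classes of left and of right $R$-modules respectively, where the module structures are $(rf)(c)=f(cr)$ and $(y\otimes c)r=y\otimes cr$. For a class $\mathcal F$ of modules, a homomorphism $f:F\to M$ with $F\in\mathcal F$ is an *$\mathcal F$-precover* of $M$ if every homomorphism $F'\to M$ with $F'\in\mathcal F$ factors through $f$; it is an *$\mathcal F$-cover* if moreover every $g:F\to F$ with $fg=f$ is an isomorphism. Dually, $f:M\to F$ with $F\in\mathcal F$ is an *$\mathcal F$-preenvelope* if every homomorphism $M\to F'$ with $F'\in\mathcal F$ factors through $f$, and an *$\mathcal F$-envelope* if moreover every $g:F\to F$ with $gf=f$ is an isomorphism. **Corollary 3.14.** The following assertions are equivalent: (i) every $R$-module has a monic $Cfp_nI(R)$-cover; (ii) every $R^{op}$-module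 has an epic $Cfp_nF(R^{op})$-envelope; (iii) every quotient of a module in $Cfp_nI(R)$ is in $Cfp_nI(R)$; (iv) every submodule of a module in $Cfp_nF(R^{op})$ is in $Cfp_nF(R^{op})$. Moreover, if $R$ is $n$-coherent and $C$ is faithfully semidualizing, then (i)–(iv) are also equivalent to each of: (v) the kernel of any $Cfp_nI(R)$-precover of any $R$-module is in $Cfp_nI(R)$; (vi) the cokernel of any $Cfp_nF(R^{op})$-preenvelope of any $R^{op}$-module is in $Cfp_nF(R^{op})$. -/

import Mathlib

/-!
Conventions. `R`-modules are left modules, and right `R`-modules (that is, `R^op`-modules) are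
modules over `Rᵐᵒᵖ`; so `m r` is written `MulOpposite.op r • m`. An `(S, R)`-bimodule `C` is a module
over `S` and over `Rᵐᵒᵖ` whose two actions commute.
-/

open CategoryTheory TensorProduct

universe u

namespace CfpModules

section Presentations

variable (R : Type u) [Ring R]

/-- `M` is finitely `n`-presented: there is an exact sequence `F n ⟶ ⋯ ⟶ F 1 ⟶ F 0 ⟶ M ⟶ 0` where
each `F i = R ^ (r i)` is finitely generated free (only the data with indices at most `n` are
constrained, the other ones are irrelevant). -/
def FinitelyNPresented (n : ℕ) (M : Type u) [AddCommGroup M] [Module R M] : Prop :=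
  ∃ (r : ℕ → ℕ) (d : ∀ i, (Fin (r (i + 1)) → R) →ₗ[R] (Fin (r i) → R))
    (ε : (Fin (r 0) → R) →ₗ[R] M),
    Function.Surjective ε ∧ (0 < n → Function.Exact (d 0) ε) ∧
      ∀ i, i + 1 < n → Function.Exact (d (i + 1)) (d i)

/-- `M` has a resolution `⋯ ⟶ F 1 ⟶ F 0 ⟶ M ⟶ 0` by finitely generated free modules (equivalently,
by finitely generated projective modules). -/
def HasDegreewiseFiniteResolution (M : Type u) [AddCommGroup M] [Module R M] : Prop :=
  ∃ (r : ℕ → ℕ) (d : ∀ i, (Fin (r (i + 1)) → R) →ₗ[R] (Fin (r i) → R))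
    (ε : (Fin (r 0) → R) →ₗ[R] M),
    Function.Surjective ε ∧ Function.Exact (d 0) ε ∧ ∀ i, Function.Exact (d (i + 1)) (d i)

/-- The ring `R` is (left) `n`-coherent: every finitely `n`-presented `R`-module is finitely
`(n + 1)`-presented. -/
def IsNCoherent (n : ℕ) : Prop :=
  ∀ (M : Type u) [AddCommGroup M] [Module R M],
    FinitelyNPresented R n M → FinitelyNPresented R (n + 1) M

end Presentations

section Tensor

/-- The relations `(r c) ⊗ y = c ⊗ (y r)` inside `C ⊗_ℤ Y`, for a left `R`-module `C` and a right
`R`-module `Y`, as a `B`-submodule for a ring `B` whose action on `C` commutes with that of `R`. (The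
set of generators is then stable under `B`, so its `B`-span is its additive span.) -/
def tensorRelations (R : Type*) (B : Type*) [Ring R] [Ring B] (C Y : Type*) [AddCommGroup C]
    [Module R C] [Module B C] [AddCommGroup Y] [Module Rᵐᵒᵖ Y] : Submodule B (C ⊗[ℤ] Y) :=
  Submodule.span B {t | ∃ (r : R) (c : C) (y : Y),
    t = (r • c) ⊗ₜ[ℤ] y - c ⊗ₜ[ℤ] (MulOpposite.op r • y)}

/-- For a right `R`-module `Y` and a left `R`-module `C`, this is the tensor product `Y ⊗_R C`, with
its factors written in the opposite order. A ring `B` whose action on `C` commutes with that of `R`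
acts on it through `C`; for `B = ℤ` this is the underlying abelian group. -/
abbrev RTensor (R : Type*) (B : Type*) [Ring R] [Ring B] (C Y : Type*) [AddCommGroup C]
    [Module R C] [Module B C] [AddCommGroup Y] [Module Rᵐᵒᵖ Y] : Type _ :=
  (C ⊗[ℤ] Y) ⧸ tensorRelations R B C Y

/-- The homomorphism of abelian groups `Y ⊗_R K ⟶ Y ⊗_R L`, `y ⊗ k ↦ y ⊗ f k`, induced by an
`R`-linear map `f : K ⟶ L`. -/
def RTensor.map {R : Type*} [Ring R] {K L : Type*} [AddCommGroup K] [Module R K]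
    [AddCommGroup L] [Module R L] (f : K →ₗ[R] L) (Y : Type*) [AddCommGroup Y] [Module Rᵐᵒᵖ Y] :
    RTensor R ℤ K Y →ₗ[ℤ] RTensor R ℤ L Y :=
  Submodule.mapQ _ _ (TensorProduct.map f.toAddMonoidHom.toIntLinearMap LinearMap.id) <| by
    rw [tensorRelations, Submodule.span_le]
    rintro _ ⟨r, k, y, rfl⟩
    exact Submodule.subset_span ⟨r, f k, y, by simp⟩

end Tensor

section FpInjectiveFlat

/-- A left `R`-module `M` is `fp_n`-injective: for every injective homomorphism `K ⟶ L` between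
finitely `n`-presented `R`-modules, `Hom_R(L, M) ⟶ Hom_R(K, M)` is surjective. -/
def IsFpInjective (R : Type u) [Ring R] (n : ℕ) (M : Type u) [AddCommGroup M] [Module R M] : Prop :=
  ∀ (K L : Type u) [AddCommGroup K] [Module R K] [AddCommGroup L] [Module R L],
    FinitelyNPresented R n K → FinitelyNPresented R n L →
    ∀ f : K →ₗ[R] L, Function.Injective f →
      Function.Surjective (fun g : L →ₗ[R] M => g.comp f)

/-- A right `R`-module `Y` is `fp_n`-flat (as a module over `R^op`): for every injective homomorphism
`K ⟶ L` between finitely `n`-presented left `R`-modules, `Y ⊗_R K ⟶ Y ⊗_R L` is injective. -/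
def IsFpFlatRight (R : Type u) [Ring R] (n : ℕ) (Y : Type u) [AddCommGroup Y] [Module Rᵐᵒᵖ Y] :
    Prop :=
  ∀ (K L : Type u) [AddCommGroup K] [Module R K] [AddCommGroup L] [Module R L],
    FinitelyNPresented R n K → FinitelyNPresented R n L →
    ∀ f : K →ₗ[R] L, Function.Injective f → Function.Injective (RTensor.map f Y)

end FpInjectiveFlat

section Bimodule

variable (S R C : Type u) [Ring S] [Ring R] [AddCommGroup C] [Module S C] [Module Rᵐᵒᵖ C]
  [SMulCommClass S Rᵐᵒᵖ C]

/-- `C` is a semidualizing `(S, R)`-bimodule. -/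
structure IsSemidualizing : Prop where
  /-- `C` has a degreewise finite resolution as a left `S`-module. -/
  resolution_left : HasDegreewiseFiniteResolution S C
  /-- `C` has a degreewise finite resolution as a right `R`-module. -/
  resolution_right : HasDegreewiseFiniteResolution Rᵐᵒᵖ C
  /-- The homothety map `S ⟶ Hom_{R^op}(C, C)`, `s ↦ (c ↦ s c)`, is an isomorphism. -/
  homothety_left : Function.Bijective (fun (s : S) => Module.toModuleEnd Rᵐᵒᵖ C s)
  /-- The homothety map `R ⟶ Hom_S(C, C)`, `r ↦ (c ↦ c r)`, is an isomorphism. -/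
  homothety_right : Function.Bijective
    (fun (r : R) => haveI := SMulCommClass.symm S Rᵐᵒᵖ C
      Module.toModuleEnd S C (MulOpposite.op r))
  /-- `Ext_S^i(C, C) = 0` for `i ≥ 1`. -/
  ext_left : ∀ i : ℕ, 1 ≤ i → Subsingleton (Abelian.Ext (ModuleCat.of S C) (ModuleCat.of S C) i)
  /-- `Ext_{R^op}^i(C, C) = 0` for `i ≥ 1`. -/
  ext_right : ∀ i : ℕ, 1 ≤ i →
    Subsingleton (Abelian.Ext (ModuleCat.of Rᵐᵒᵖ C) (ModuleCat.of Rᵐᵒᵖ C) i)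

/-- `C` is a faithfully semidualizing `(S, R)`-bimodule. -/
structure IsFaithfullySemidualizing : Prop extends IsSemidualizing S R C where
  /-- If `Hom_S(C, N) = 0` then `N = 0`, for every left `S`-module `N`. -/
  faithful_left : ∀ (N : Type u) [AddCommGroup N] [Module S N],
    Subsingleton (C →ₗ[S] N) → Subsingleton N
  /-- If `Hom_{R^op}(C, M) = 0` then `M = 0`, for every right `R`-module `M`. -/
  faithful_right : ∀ (M : Type u) [AddCommGroup M] [Module Rᵐᵒᵖ M],
    Subsingleton (C →ₗ[Rᵐᵒᵖ] M) → Subsingleton M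

/-- The abelian group `Hom_S(C, X)`, for an `(S, R)`-bimodule `C` and an `S`-module `X`, made into a
left `R`-module below. -/
def HomModule (_R X : Type u) [AddCommGroup X] [Module S X] : Type u := C →ₗ[S] X

instance (X : Type u) [AddCommGroup X] [Module S X] : AddCommGroup (HomModule S C R X) :=
  inferInstanceAs (AddCommGroup (C →ₗ[S] X))

/-- The left `R`-module structure on `Hom_S(C, X)`: `(r f)(c) = f (c r)`. -/
instance (X : Type u) [AddCommGroup X] [Module S X] : Module R (HomModule S C R X) where
  smul r f := LinearMap.comp (show C →ₗ[S] X from f)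
    (haveI := SMulCommClass.symm S Rᵐᵒᵖ C; Module.toModuleEnd S C (MulOpposite.op r))
  one_smul f := LinearMap.ext fun c =>
    congrArg (show C →ₗ[S] X from f) (one_smul Rᵐᵒᵖ c)
  mul_smul r s f := LinearMap.ext fun c =>
    congrArg (show C →ₗ[S] X from f) (mul_smul (MulOpposite.op s) (MulOpposite.op r) c)
  smul_zero _ := LinearMap.zero_comp _
  smul_add _ _ _ := LinearMap.add_comp _ _ _
  add_smul r s f := LinearMap.ext fun c =>
    (congrArg (show C →ₗ[S] X from f) (add_smul (MulOpposite.op r) (MulOpposite.op s) c)).trans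
      (map_add (show C →ₗ[S] X from f) _ _)
  zero_smul f := LinearMap.ext fun c =>
    (congrArg (show C →ₗ[S] X from f) (zero_smul Rᵐᵒᵖ c)).trans
      (map_zero (show C →ₗ[S] X from f))

/-- The class `Cfp_nI(R)` of `C`-`fp_n`-injective `R`-modules: the left `R`-modules (isomorphic to one)
of the form `Hom_S(C, X)` with `X` an `fp_n`-injective left `S`-module. -/
def CfpInjective (n : ℕ) : ObjectProperty (ModuleCat.{u} R) := fun M =>
  ∃ X : ModuleCat.{u} S, IsFpInjective S n X ∧ Nonempty (M ≃ₗ[R] HomModule S C R X)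

/-- The class `Cfp_nF(R^op)` of `C`-`fp_n`-flat `R^op`-modules: the right `R`-modules (isomorphic to
one) of the form `C ⊗_{S^op} Y = Y ⊗_S C` with `Y` an `fp_n`-flat right `S`-module. -/
def CfpFlatRight (n : ℕ) : ObjectProperty (ModuleCat.{u} Rᵐᵒᵖ) := fun N =>
  ∃ Y : ModuleCat.{u} Sᵐᵒᵖ, IsFpFlatRight S n Y ∧ Nonempty (N ≃ₗ[Rᵐᵒᵖ] RTensor S Rᵐᵒᵖ C Y)

end Bimodule

section Approximations

variable {𝒜 : Type*} [Category* 𝒜] (F : ObjectProperty 𝒜)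

/-- `f : X ⟶ M` is an `F`-precover of `M`. -/
structure IsPrecover {X M : 𝒜} (f : X ⟶ M) : Prop where
  mem : F X
  lift : ∀ X' : 𝒜, F X' → ∀ g : X' ⟶ M, ∃ h : X' ⟶ X, h ≫ f = g

/-- `f : M ⟶ X` is an `F`-preenvelope of `M`. -/
structure IsPreenvelope {M X : 𝒜} (f : M ⟶ X) : Prop where
  mem : F X
  extend : ∀ X' : 𝒜, F X' → ∀ g : M ⟶ X', ∃ h : X ⟶ X', f ≫ h = g

/-- `f : X ⟶ M` is an `F`-cover of `M`. -/
structure IsCover {X M : 𝒜} (f : X ⟶ M) : Prop extends IsPrecover F f where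
  isIso_of_comp : ∀ g : X ⟶ X, g ≫ f = f → IsIso g

/-- `f : M ⟶ X` is an `F`-envelope of `M`. -/
structure IsEnvelope {M X : 𝒜} (f : M ⟶ X) : Prop extends IsPreenvelope F f where
  isIso_of_comp : ∀ g : X ⟶ X, f ≫ g = f → IsIso g

end Approximations

section Closure

variable {A : Type u} [Ring A] (F : ObjectProperty (ModuleCat.{u} A))

/-- Every module has an `F`-cover that is a monomorphism. -/
def HasMonicCovers : Prop :=
  ∀ M : ModuleCat.{u} A, ∃ (X : ModuleCat.{u} A) (f : X ⟶ M), IsCover F f ∧ Mono f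

/-- Every module has an `F`-envelope that is an epimorphism. -/
def HasEpicEnvelopes : Prop :=
  ∀ M : ModuleCat.{u} A, ∃ (X : ModuleCat.{u} A) (f : M ⟶ X), IsEnvelope F f ∧ Epi f

/-- Every quotient of a module in `F` is in `F`. -/
def ClosedUnderQuotients : Prop :=
  ∀ M : ModuleCat.{u} A, F M → ∀ N : Submodule A M, F (ModuleCat.of A (M ⧸ N))

/-- Every submodule of a module in `F` is in `F`. -/
def ClosedUnderSubmodules : Prop :=
  ∀ M : ModuleCat.{u} A, F M → ∀ N : Submodule A M, F (ModuleCat.of A N)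

/-- The kernel of every `F`-precover of every module is in `F`. -/
def KernelsOfPrecoversMem : Prop :=
  ∀ (M X : ModuleCat.{u} A) (f : X ⟶ M), IsPrecover F f →
    F (ModuleCat.of A (LinearMap.ker f.hom))

/-- The cokernel of every `F`-preenvelope of every module is in `F`. -/
def CokernelsOfPreenvelopesMem : Prop :=
  ∀ (M X : ModuleCat.{u} A) (f : M ⟶ X), IsPreenvelope F f →
    F (ModuleCat.of A (X ⧸ LinearMap.range f.hom))

end Closure

end CfpModules

/-! Write `M⁺` for the group of characters of `M` with values in `ℚ/ℤ`. Characters exchange the two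
classes: `M` is in `Cfp_nI(R)` exactly when `M⁺` is in `Cfp_nF(R^op)`, and `N` is in `Cfp_nF(R^op)`
exactly when `N⁺` is in `Cfp_nI(R)`. As `⁺` turns quotients into submodules and conversely, (iii)
and (iv) are equivalent.

The forward halves are Hom-tensor adjunction and the isomorphism `Hom(C, X)⁺ ≅ X⁺ ⊗ C` for finitely
presented `C`. The backward halves use that evaluation `C ⊗ Hom(C, X) → X` is bijective for `X`
`fp_n`-injective (`exists_eq_sum_apply`, `exists_of_sum_apply_eq_zero`): a presentation of `C` as a
right module dualizes to an exact sequence `0 → R → C^a → C^b`, along which maps into `X` extend.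
Hence `N⁺ ≅ Hom(C, X)` forces `X ≅ Hom(C, N)⁺` and `N ≅ Hom(C, N) ⊗ C` (`CfpFlatRight.of_charLeft`),
and a pure submodule of `Hom(C, X)` is `Hom(C, X')` with `X'` pure in `X`
(`CfpInjective.of_isPure_homModule`); the latter is applied to `M → M⁺⁺`.

Both classes are closed under products, and `Cfp_nI(R)` under direct sums, which are pure in
products. So under (iii) the sum of all submodules in `Cfp_nI(R)` is a monic cover, and under (iv)
the image of a module in the product of its quotients in `Cfp_nF(R^op)` is an epic envelope.
Conversely, a monic cover of a quotient of a member is onto, and dually.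

Under (iii) the image of a precover splits off, so its kernel is a quotient of a member: this is
(v). Characters turn preenvelopes into precovers, whence (vi). Under (vi), a preenvelope `N → X` of
a submodule of a member is monic, and `0 → (X/N)⁺ → X⁺ → N⁺ → 0` has its first two terms in
`Cfp_nI(R)`; coherence and faithfulness put `N⁺` there too (`CfpInjective.of_exact`). Preenvelopes
exist because maps into `Y ⊗ C` factor through `Y' ⊗ C` with `Y'` pure in `Y` and of bounded size.
-/

namespace CfpModules

/-! ### Finitely `n`-presented modules. -/

section FinitelyNPresented

variable {R : Type u} [Ring R]

theorem finitelyNPresented_zero_iff {M : Type u} [AddCommGroup M] [Module R M] :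
    FinitelyNPresented R 0 M ↔ Module.Finite R M := by
  constructor
  · rintro ⟨r, d, ε, hε, -, -⟩
    exact Module.Finite.of_surjective ε hε
  · intro h
    obtain ⟨k, ε, hε⟩ := Module.Finite.exists_fin' R M
    exact ⟨fun _ => k, fun _ => 0, ε, hε, fun h => absurd h (lt_irrefl _),
      fun i h => absurd h (Nat.not_lt_zero _)⟩

theorem finitelyNPresented_succ_iff {n : ℕ} {M : Type u} [AddCommGroup M] [Module R M] :
    FinitelyNPresented R (n + 1) M ↔ ∃ (k : ℕ) (ε : (Fin k → R) →ₗ[R] M),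
      Function.Surjective ε ∧ FinitelyNPresented R n (LinearMap.ker ε) := by
  constructor
  · rintro ⟨r, d, ε, hε, h0, h⟩
    have h0 := h0 (Nat.succ_pos n)
    refine ⟨r 0, ε, hε, fun i => r (i + 1), fun i => d (i + 1),
      (d 0).codRestrict _ fun x => h0.apply_apply_eq_zero x, ?_, ?_, ?_⟩
    · rintro ⟨x, hx⟩
      obtain ⟨y, rfl⟩ := (h0 x).1 hx
      exact ⟨y, rfl⟩
    · intro hn x
      rw [← h 0 (by omega) x]
      exact Subtype.ext_iff
    · intro i hi
      exact h (i + 1) (by omega)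
  · rintro ⟨k, ε, hε, r, d, ε', hε', h0, h⟩
    let r' : ℕ → ℕ := fun i => Nat.casesOn i k r
    let d' : ∀ i, (Fin (r' (i + 1)) → R) →ₗ[R] (Fin (r' i) → R) := fun i =>
      match i with
      | 0 => (LinearMap.ker ε).subtype ∘ₗ ε'
      | i + 1 => d i
    refine ⟨r', d', ε, hε, fun _ x => ?_, ?_⟩
    · constructor
      · intro hx
        obtain ⟨y, hy⟩ := hε' ⟨x, hx⟩
        exact ⟨y, congrArg Subtype.val hy⟩
      · rintro ⟨y, rfl⟩
        exact (ε' y).2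
    · rintro (_ | i) hi
      · intro x
        rw [← h0 (by omega) x]
        exact (Subtype.ext_iff (a1 := ε' x) (a2 := 0)).symm
      · exact h i (by omega)

theorem FinitelyNPresented.of_succ {n : ℕ} {M : Type u} [AddCommGroup M] [Module R M]
    (h : FinitelyNPresented R (n + 1) M) : FinitelyNPresented R n M := by
  obtain ⟨r, d, ε, hε, h0, h⟩ := h
  exact ⟨r, d, ε, hε, fun _ => h0 n.succ_pos, fun i hi => h i (by omega)⟩

theorem HasDegreewiseFiniteResolution.finitelyNPresented {M : Type u} [AddCommGroup M]
    [Module R M] (h : HasDegreewiseFiniteResolution R M) (n : ℕ) : FinitelyNPresented R n M := by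
  obtain ⟨r, d, ε, hε, h0, h⟩ := h
  exact ⟨r, d, ε, hε, fun _ => h0, fun i _ => h i⟩

theorem FinitelyNPresented.of_equiv {n : ℕ} {M N : Type u} [AddCommGroup M] [Module R M]
    [AddCommGroup N] [Module R N] (h : FinitelyNPresented R n M) (e : M ≃ₗ[R] N) :
    FinitelyNPresented R n N := by
  obtain ⟨r, d, ε, hε, h0, h⟩ := h
  refine ⟨r, d, e.toLinearMap ∘ₗ ε, e.surjective.comp hε, fun hn x => ?_, h⟩
  rw [← h0 hn x]
  simp

theorem finitelyNPresented_of_subsingleton (n : ℕ) (M : Type u) [AddCommGroup M] [Module R M]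
    [Subsingleton M] : FinitelyNPresented R n M :=
  ⟨fun _ => 0, fun _ => 0, 0, fun _ => ⟨0, Subsingleton.elim _ _⟩,
    fun _ _ => ⟨fun _ => ⟨0, Subsingleton.elim _ _⟩, fun _ => Subsingleton.elim _ _⟩,
    fun _ _ _ => ⟨fun _ => ⟨0, Subsingleton.elim _ _⟩, fun _ => Subsingleton.elim _ _⟩⟩

theorem finitelyNPresented_fin (n k : ℕ) : FinitelyNPresented R n (Fin k → R) := by
  refine FinitelyNPresented.of_succ (finitelyNPresented_succ_iff.2
    ⟨k, LinearMap.id, Function.surjective_id, ?_⟩)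
  rw [LinearMap.ker_id]
  exact finitelyNPresented_of_subsingleton n _

theorem finitelyNPresented_self (n : ℕ) : FinitelyNPresented R n R :=
  (finitelyNPresented_fin n 1).of_equiv (LinearEquiv.funUnique (Fin 1) R R)

/-- Horseshoe lemma: free covers of the two ends combine to one of the middle, and its kernel is
again an extension of the two kernels, so induction on `n` applies. -/
theorem FinitelyNPresented.extension {n : ℕ} : ∀ {A B D : Type u} [AddCommGroup A] [Module R A]
    [AddCommGroup B] [Module R B] [AddCommGroup D] [Module R D] (i : A →ₗ[R] B) (q : B →ₗ[R] D),
    Function.Injective i → Function.Exact i q → Function.Surjective q →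
    FinitelyNPresented R n A → FinitelyNPresented R n D → FinitelyNPresented R n B := by
  induction n with
  | zero =>
    intro A B D _ _ _ _ _ _ i q hi hiq hq hA hD
    rw [finitelyNPresented_zero_iff] at *
    have : Module.Finite R (LinearMap.ker q) := by
      rw [hiq.linearMap_ker_eq]
      infer_instance
    have : Module.Finite R (B ⧸ LinearMap.ker q) :=
      Module.Finite.equiv (q.quotKerEquivOfSurjective hq).symm
    exact Module.Finite.of_submodule_quotient (LinearMap.ker q)
  | succ n ih =>
    intro A B D _ _ _ _ _ _ i q hi hiq hq hA hD
    obtain ⟨k, εA, hεA, hkA⟩ := finitelyNPresented_succ_iff.1 hA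
    obtain ⟨l, εD, hεD, hkD⟩ := finitelyNPresented_succ_iff.1 hD
    obtain ⟨σ, hσ⟩ := Module.projective_lifting_property q εD hq
    have hσ' : ∀ x, q (σ x) = εD x := fun x => LinearMap.congr_fun hσ x
    let e : (Fin (k + l) → R) ≃ₗ[R] (Fin k → R) × (Fin l → R) :=
      (LinearEquiv.funCongrLeft R R finSumFinEquiv).trans
        (LinearEquiv.sumArrowLequivProdArrow (Fin k) (Fin l) R R)
    let ε : (Fin (k + l) → R) →ₗ[R] B := ((i ∘ₗ εA).coprod σ) ∘ₗ e.toLinearMap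
    have hε' : ∀ x, ε x = i (εA (e x).1) + σ (e x).2 := fun x => rfl
    refine finitelyNPresented_succ_iff.2 ⟨k + l, ε, ?_, ?_⟩
    · intro b
      obtain ⟨v, hv⟩ := hεD (q b)
      obtain ⟨a, ha⟩ := (hiq (b - σ v)).1 (by rw [map_sub, hσ', hv, sub_self])
      obtain ⟨w, rfl⟩ := hεA a
      refine ⟨e.symm (w, v), ?_⟩
      rw [hε', e.apply_symm_apply, ha, sub_add_cancel]
    · refine ih (A := LinearMap.ker εA) (D := LinearMap.ker εD)
        ((e.symm.toLinearMap ∘ₗ LinearMap.inl R _ _ ∘ₗ (LinearMap.ker εA).subtype).codRestrict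
          (LinearMap.ker ε) fun x => ?_)
        ((LinearMap.snd R _ _ ∘ₗ e.toLinearMap ∘ₗ (LinearMap.ker ε).subtype).codRestrict _
          fun x => ?_) ?_ ?_ ?_ hkA hkD
      · rw [LinearMap.mem_ker, hε']
        simp
      · have hx : ε x = 0 := x.2
        have := congrArg q hx
        rw [hε', map_add, hiq.apply_apply_eq_zero, zero_add, hσ', map_zero] at this
        exact this
      · intro x y hxy
        have := e.symm.injective (congrArg Subtype.val hxy)
        exact Subtype.ext (Prod.ext_iff.1 this).1
      · intro x
        constructor
        · intro hx
          have hx2 : (e x).2 = 0 := congrArg Subtype.val hx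
          have hx0 : ε x = 0 := x.2
          rw [hε', hx2, map_zero, add_zero] at hx0
          refine ⟨⟨(e x).1, hi (hx0.trans (map_zero i).symm)⟩, Subtype.ext ?_⟩
          exact (LinearEquiv.symm_apply_eq e).2 (Prod.ext rfl hx2.symm)
        · rintro ⟨y, rfl⟩
          refine Subtype.ext ?_
          change (e (e.symm (y.1, 0))).2 = 0
          rw [e.apply_symm_apply]
      · rintro ⟨v, hv⟩
        obtain ⟨a, ha⟩ := (hiq (- σ v)).1 (by rw [map_neg, hσ', LinearMap.mem_ker.1 hv, neg_zero])
        obtain ⟨w, rfl⟩ := hεA a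
        refine ⟨⟨e.symm (w, v), ?_⟩, Subtype.ext ?_⟩
        · rw [LinearMap.mem_ker, hε', e.apply_symm_apply, ha, neg_add_cancel]
        · change (e (e.symm (w, v))).2 = v
          rw [e.apply_symm_apply]

theorem FinitelyNPresented.pow {n : ℕ} {M : Type u} [AddCommGroup M] [Module R M]
    (h : FinitelyNPresented R n M) (a : ℕ) : FinitelyNPresented R n (Fin a → M) := by
  induction a with
  | zero => exact finitelyNPresented_of_subsingleton n _
  | succ a ih =>
    refine FinitelyNPresented.extension
      (LinearMap.pi (Fin.cases 0 fun j => LinearMap.proj j) : (Fin a → M) →ₗ[R] (Fin (a + 1) → M))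
      (LinearMap.proj 0) ?_ ?_ ?_ ih h
    · intro x y hxy
      ext j
      exact congrFun hxy j.succ
    · intro x
      constructor
      · intro hx
        refine ⟨fun j => x j.succ, funext fun j => ?_⟩
        induction j using Fin.cases with
        | zero => exact hx.symm
        | succ j => rfl
      · rintro ⟨y, rfl⟩
        rfl
    · exact fun m => ⟨fun _ => m, rfl⟩

/-- The kernel of `R^k → L → L / f(K)` is an extension of `K` by the kernel of `R^k → L`; only one
degree less of presentation is needed from `K`. -/
theorem FinitelyNPresented.quotient_range {n : ℕ} {K L : Type u} [AddCommGroup K] [Module R K]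
    [AddCommGroup L] [Module R L] (hK : FinitelyNPresented R n K) (hL : FinitelyNPresented R n L)
    (f : K →ₗ[R] L) (hf : Function.Injective f) :
    FinitelyNPresented R n (L ⧸ LinearMap.range f) := by
  cases n with
  | zero =>
    rw [finitelyNPresented_zero_iff] at *
    infer_instance
  | succ n =>
    obtain ⟨k, ε, hε, hk⟩ := finitelyNPresented_succ_iff.1 hL
    refine finitelyNPresented_succ_iff.2 ⟨k, (LinearMap.range f).mkQ ∘ₗ ε,
      (Submodule.mkQ_surjective _).comp hε, ?_⟩
    have hmem : ∀ x, x ∈ LinearMap.ker ((LinearMap.range f).mkQ ∘ₗ ε) ↔ ε x ∈ LinearMap.range f := by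
      intro x
      simp
    refine FinitelyNPresented.extension (A := LinearMap.ker ε) (D := LinearMap.range f)
      (Submodule.inclusion fun x hx => (hmem x).2 ?_)
      ((ε ∘ₗ Submodule.subtype _).codRestrict _ fun x => (hmem x).1 x.2)
      (Submodule.inclusion_injective _) ?_ ?_ hk
      (hK.of_succ.of_equiv (LinearEquiv.ofInjective f hf))
    · rw [LinearMap.mem_ker.1 hx]
      exact zero_mem _
    · intro x
      constructor
      · intro hx
        exact ⟨⟨x, congrArg Subtype.val hx⟩, rfl⟩
      · rintro ⟨y, rfl⟩
        exact Subtype.ext y.2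
    · rintro ⟨y, hy⟩
      obtain ⟨x, rfl⟩ := hε y
      exact ⟨⟨x, (hmem x).2 hy⟩, rfl⟩

end FinitelyNPresented

/-! ### Finite presentations by generators and relations. -/

section Presentation

variable {A : Type*} [Ring A] {M : Type*} [AddCommGroup M] [Module A M]

/-- The family `g` generates `M`, and the rows of `B` generate the module of relations of `g`. -/
structure IsPresentation {a b : ℕ} (g : Fin a → M) (B : Fin b → Fin a → A) : Prop where
  span : ∀ m, ∃ r : Fin a → A, ∑ i, r i • g i = m
  rel : ∀ j, ∑ i, B j i • g i = 0
  exact : ∀ r : Fin a → A, ∑ i, r i • g i = 0 → ∃ s : Fin b → A, ∀ i, r i = ∑ j, s j * B j i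

theorem sum_smul_single_one {ι : Type*} [Fintype ι] [DecidableEq ι] (x : ι → A) :
    ∑ i, x i • (Pi.single i 1 : ι → A) = x := by
  ext j
  simp [Finset.sum_apply, Pi.single_apply]

/-- This is the entry point of `n ≥ 1`: it makes every test module finitely presented. -/
theorem FinitelyNPresented.exists_isPresentation {A M : Type u} [Ring A] [AddCommGroup M]
    [Module A M] {n : ℕ} (hn : 1 ≤ n) (h : FinitelyNPresented A n M) :
    ∃ (a b : ℕ) (g : Fin a → M) (B : Fin b → Fin a → A), IsPresentation g B := by
  obtain ⟨r, d, ε, hε, h0, -⟩ := h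
  have h0 := h0 hn
  have e1 : ∀ x : Fin (r 0) → A, ∑ i, x i • ε (Pi.single i 1) = ε x := fun x => by
    simp_rw [← map_smul, ← map_sum, sum_smul_single_one]
  have e2 : ∀ x : Fin (r 1) → A, ∑ j, x j • d 0 (Pi.single j 1) = d 0 x := fun x => by
    simp_rw [← map_smul, ← map_sum, sum_smul_single_one]
  refine ⟨r 0, r 1, fun i => ε (Pi.single i 1), fun j => d 0 (Pi.single j 1), ?_, ?_, ?_⟩
  · intro m
    obtain ⟨x, rfl⟩ := hε m
    exact ⟨x, e1 x⟩
  · intro j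
    rw [e1]
    exact h0.apply_apply_eq_zero _
  · intro x hx
    rw [e1] at hx
    obtain ⟨s, rfl⟩ := (h0 x).1 hx
    refine ⟨s, fun i => ?_⟩
    rw [← e2 s]
    simp

theorem exists_linearMap_comp_eq {N Z : Type*} [AddCommGroup N] [Module A N] [AddCommGroup Z]
    [Module A Z] {p : M →ₗ[A] N} (hp : Function.Surjective p) (q : M →ₗ[A] Z)
    (h : ∀ m, p m = 0 → q m = 0) : ∃ θ : N →ₗ[A] Z, ∀ m, θ (p m) = q m := by
  refine ⟨(LinearMap.ker p).liftQ q (fun m hm => h m hm) ∘ₗ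
    (p.quotKerEquivOfSurjective hp).symm.toLinearMap, fun m => ?_⟩
  rw [LinearMap.comp_apply, LinearEquiv.coe_coe,
    show p m = p.quotKerEquivOfSurjective hp (Submodule.Quotient.mk m) from rfl,
    LinearEquiv.symm_apply_apply]
  rfl

theorem exists_comp_linearMap_eq {N Z : Type*} [AddCommGroup N] [Module A N] [AddCommGroup Z]
    [Module A Z] {i : N →ₗ[A] Z} (hi : Function.Injective i) (q : M →ₗ[A] Z)
    (h : ∀ m, q m ∈ LinearMap.range i) : ∃ θ : M →ₗ[A] N, ∀ m, i (θ m) = q m :=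
  ⟨(LinearEquiv.ofInjective i hi).symm.toLinearMap ∘ₗ q.codRestrict _ h, fun m =>
    congrArg Subtype.val ((LinearEquiv.ofInjective i hi).apply_symm_apply (q.codRestrict _ h m))⟩

theorem IsPresentation.exists_linearMap {a b : ℕ} {g : Fin a → M} {B : Fin b → Fin a → A}
    (h : IsPresentation g B) {X : Type*} [AddCommGroup X] [Module A X] (x : Fin a → X)
    (hx : ∀ j, ∑ i, B j i • x i = 0) : ∃ f : M →ₗ[A] X, ∀ i, f (g i) = x i := by
  let p : (Fin a → A) →ₗ[A] M := Fintype.linearCombination A g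
  let q : (Fin a → A) →ₗ[A] X := Fintype.linearCombination A x
  have hq : ∀ r, q r = ∑ i, r i • x i := fun r => rfl
  have hps : Function.Surjective p := fun m => h.span m
  obtain ⟨f, hf⟩ := exists_linearMap_comp_eq hps q fun r hr => by
    obtain ⟨s, hs⟩ := h.exact r hr
    rw [hq]
    simp_rw [hs, Finset.sum_smul, mul_smul]
    rw [Finset.sum_comm]
    simp_rw [← Finset.smul_sum, hx, smul_zero, Finset.sum_const_zero]
  refine ⟨f, fun i => ?_⟩
  simpa [p, q] using hf (Pi.single i 1)

theorem IsPresentation.hom_ext {a b : ℕ} {g : Fin a → M} {B : Fin b → Fin a → A}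
    (h : IsPresentation g B) {X : Type*} [AddCommGroup X] [Module A X] {f f' : M →ₗ[A] X}
    (hf : ∀ i, f (g i) = f' (g i)) : f = f' := by
  ext m
  obtain ⟨r, rfl⟩ := h.span m
  simp [hf]

end Presentation

/-! ### Characters and character modules. -/

section Characters

/-- Injectivity of `ℚ/ℤ`: `χ` descends to `A / ker p`, which embeds in `B`. -/
theorem exists_character_factor {A B : Type*} [AddCommGroup A] [AddCommGroup B] (p : A →+ B)
    (χ : A →+ AddCircle (1 : ℚ)) (h : ∀ a, p a = 0 → χ a = 0) :
    ∃ χ' : B →+ AddCircle (1 : ℚ), ∀ a, χ' (p a) = χ a := by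
  let χ₀ : CharacterModule (A ⧸ p.ker) := QuotientAddGroup.lift p.ker χ h
  obtain ⟨χ', hχ'⟩ := CharacterModule.dual_surjective_of_injective
    (QuotientAddGroup.kerLift p).toIntLinearMap (QuotientAddGroup.kerLift_injective p) χ₀
  refine ⟨χ', fun a => ?_⟩
  exact DFunLike.congr_fun hχ' (QuotientAddGroup.mk a)

theorem exists_character_of_notMem {A : Type*} [AddCommGroup A] (S : AddSubgroup A) {a : A}
    (ha : a ∉ S) : ∃ χ : A →+ AddCircle (1 : ℚ), (∀ s ∈ S, χ s = 0) ∧ χ a ≠ 0 := by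
  obtain ⟨χ, hχ⟩ := CharacterModule.exists_character_apply_ne_zero_of_ne_zero
    (a := (QuotientAddGroup.mk a : A ⧸ S)) (by rwa [Ne, QuotientAddGroup.eq_zero_iff])
  let χ₁ : A ⧸ S →+ AddCircle (1 : ℚ) := χ
  refine ⟨χ₁.comp (QuotientAddGroup.mk' S), fun s hs => ?_, hχ⟩
  rw [AddMonoidHom.comp_apply, QuotientAddGroup.mk'_apply, (QuotientAddGroup.eq_zero_iff s).2 hs,
    map_zero]

/-- A character of `Hom(M, X)` extends to a character of the power of `X` given by generators of
`M`. -/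
theorem exists_character_hom {A M X : Type*} [Ring A] [AddCommGroup M] [Module A M] [AddCommGroup X]
    [Module A X] {a b : ℕ} {g : Fin a → M} {B : Fin b → Fin a → A} (h : IsPresentation g B)
    (χ : (M →ₗ[A] X) →+ AddCircle (1 : ℚ)) :
    ∃ ψ : Fin a → X →+ AddCircle (1 : ℚ), ∀ f, χ f = ∑ i, ψ i (f (g i)) := by
  let p : (M →ₗ[A] X) →+ (Fin a → X) := AddMonoidHom.mk' (fun f i => f (g i)) fun _ _ => rfl
  obtain ⟨Ψ, hΨ⟩ := exists_character_factor p χ fun f hf => by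
    rw [show f = 0 from h.hom_ext fun i => congrFun hf i, map_zero]
  refine ⟨fun i => Ψ.comp (AddMonoidHom.single (fun _ => X) i), fun f => ?_⟩
  rw [← hΨ, ← Finset.univ_sum_single (p f), map_sum]
  rfl

/-- Characters which vanish on the solutions of a system of linear equations are combinations of the
equations. -/
theorem exists_character_relations {A X : Type*} [Ring A] [AddCommGroup X] [Module A X] {a b : ℕ}
    (B : Fin b → Fin a → A) (χ : Fin a → X →+ AddCircle (1 : ℚ))
    (h : ∀ x : Fin a → X, (∀ j, ∑ i, B j i • x i = 0) → ∑ i, χ i (x i) = 0) :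
    ∃ ψ : Fin b → X →+ AddCircle (1 : ℚ), ∀ i x, χ i x = ∑ j, ψ j (B j i • x) := by
  let p : (Fin a → X) →+ (Fin b → X) :=
    AddMonoidHom.mk' (fun x j => ∑ i, B j i • x i) fun x x' => by
      ext j
      simp [Finset.sum_add_distrib]
  let Φ : (Fin a → X) →+ AddCircle (1 : ℚ) :=
    AddMonoidHom.mk' (fun x => ∑ i, χ i (x i)) fun x x' => by
      simp [Finset.sum_add_distrib]
  obtain ⟨Ψ, hΨ⟩ := exists_character_factor p Φ fun x hx => h x fun j => congrFun hx j
  refine ⟨fun j => Ψ.comp (AddMonoidHom.single (fun _ => X) j), fun i x => ?_⟩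
  have e1 : Φ (Pi.single i x) = χ i x := by
    change ∑ i', χ i' ((Pi.single i x : Fin a → X) i') = _
    rw [Finset.sum_eq_single i, Pi.single_eq_same]
    · intro j _ hj
      rw [Pi.single_eq_of_ne hj, map_zero]
    · simp
  have e2 : p (Pi.single i x) = fun j => B j i • x := by
    ext j
    change ∑ i', B j i' • ((Pi.single i x : Fin a → X) i') = _
    rw [Finset.sum_eq_single i, Pi.single_eq_same]
    · intro j _ hj
      rw [Pi.single_eq_of_ne hj, smul_zero]
    · simp
  rw [← e1, ← hΨ, e2, ← Finset.univ_sum_single (fun j => B j i • x), map_sum]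
  rfl

variable (R : Type*) [Ring R]

/-- The character module of a right module, as a left module. -/
def CharLeft (Y : Type*) [AddCommGroup Y] : Type _ := Y →+ AddCircle (1 : ℚ)

/-- The character module of a left module, as a right module. -/
def CharRight (X : Type*) [AddCommGroup X] : Type _ := X →+ AddCircle (1 : ℚ)

section

variable (Y : Type*) [AddCommGroup Y]

instance : AddCommGroup (CharLeft Y) := inferInstanceAs (AddCommGroup (Y →+ AddCircle (1 : ℚ)))

instance : FunLike (CharLeft Y) Y (AddCircle (1 : ℚ)) :=
  inferInstanceAs (FunLike (Y →+ AddCircle (1 : ℚ)) Y (AddCircle (1 : ℚ)))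

instance : AddMonoidHomClass (CharLeft Y) Y (AddCircle (1 : ℚ)) :=
  inferInstanceAs (AddMonoidHomClass (Y →+ AddCircle (1 : ℚ)) Y (AddCircle (1 : ℚ)))

instance : AddCommGroup (CharRight Y) := inferInstanceAs (AddCommGroup (Y →+ AddCircle (1 : ℚ)))

instance : FunLike (CharRight Y) Y (AddCircle (1 : ℚ)) :=
  inferInstanceAs (FunLike (Y →+ AddCircle (1 : ℚ)) Y (AddCircle (1 : ℚ)))

instance : AddMonoidHomClass (CharRight Y) Y (AddCircle (1 : ℚ)) :=
  inferInstanceAs (AddMonoidHomClass (Y →+ AddCircle (1 : ℚ)) Y (AddCircle (1 : ℚ)))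

instance [Module Rᵐᵒᵖ Y] : Module R (CharLeft Y) where
  smul r φ := AddMonoidHom.comp (show Y →+ AddCircle (1 : ℚ) from φ)
    (DistribSMul.toAddMonoidHom Y (MulOpposite.op r))
  one_smul φ := DFunLike.ext _ _ fun y => congrArg φ (one_smul Rᵐᵒᵖ y)
  mul_smul r s φ := DFunLike.ext _ _ fun y =>
    congrArg φ (mul_smul (MulOpposite.op s) (MulOpposite.op r) y)
  smul_zero _ := rfl
  smul_add _ _ _ := rfl
  add_smul r s φ := DFunLike.ext _ _ fun y =>
    (congrArg φ (add_smul (MulOpposite.op r) (MulOpposite.op s) y)).trans (map_add φ _ _)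
  zero_smul φ := DFunLike.ext _ _ fun y => (congrArg φ (zero_smul Rᵐᵒᵖ y)).trans (map_zero φ)

instance [Module R Y] : Module Rᵐᵒᵖ (CharRight Y) where
  smul r φ := AddMonoidHom.comp (show Y →+ AddCircle (1 : ℚ) from φ)
    (DistribSMul.toAddMonoidHom Y r.unop)
  one_smul φ := DFunLike.ext _ _ fun y => congrArg φ (one_smul R y)
  mul_smul r s φ := DFunLike.ext _ _ fun y => congrArg φ (mul_smul s.unop r.unop y)
  smul_zero _ := rfl
  smul_add _ _ _ := rfl
  add_smul r s φ := DFunLike.ext _ _ fun y =>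
    (congrArg φ (add_smul r.unop s.unop y)).trans (map_add φ _ _)
  zero_smul φ := DFunLike.ext _ _ fun y => (congrArg φ (zero_smul R y)).trans (map_zero φ)

end

/-- A character as an element of the character module of a right module. -/
def CharLeft.of {Y : Type*} [AddCommGroup Y] (χ : Y →+ AddCircle (1 : ℚ)) : CharLeft Y := χ

/-- A character as an element of the character module of a left module. -/
def CharRight.of {X : Type*} [AddCommGroup X] (χ : X →+ AddCircle (1 : ℚ)) : CharRight X := χ

@[simp] theorem CharLeft.smul_apply {R Y : Type*} [Ring R] [AddCommGroup Y] [Module Rᵐᵒᵖ Y] (r : R)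
    (φ : CharLeft Y) (y : Y) : (r • φ) y = φ (MulOpposite.op r • y) := rfl

@[simp] theorem CharRight.smul_apply {R X : Type*} [Ring R] [AddCommGroup X] [Module R X] (r : Rᵐᵒᵖ)
    (φ : CharRight X) (x : X) : (r • φ) x = φ (r.unop • x) := rfl

@[simp] theorem CharRight.add_apply {X : Type*} [AddCommGroup X] (φ ψ : CharRight X) (x : X) :
    (φ + ψ) x = φ x + ψ x := rfl

@[simp] theorem CharLeft.zero_apply {Y : Type*} [AddCommGroup Y] (y : Y) :
    (0 : CharLeft Y) y = 0 := rfl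

@[simp] theorem CharRight.zero_apply {X : Type*} [AddCommGroup X] (x : X) :
    (0 : CharRight X) x = 0 := rfl

@[simp] theorem CharLeft.sum_apply {Y ι : Type*} [AddCommGroup Y] (s : Finset ι) (φ : ι → CharLeft Y)
    (y : Y) : (∑ i ∈ s, φ i) y = ∑ i ∈ s, φ i y :=
  map_sum (AddMonoidHom.mk' (fun φ : CharLeft Y => φ y) fun _ _ => rfl) φ s

@[simp] theorem CharRight.sum_apply {X ι : Type*} [AddCommGroup X] (s : Finset ι)
    (φ : ι → CharRight X) (x : X) : (∑ i ∈ s, φ i) x = ∑ i ∈ s, φ i x :=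
  map_sum (AddMonoidHom.mk' (fun φ : CharRight X => φ x) fun _ _ => rfl) φ s

/-- The homomorphism of character modules induced by a homomorphism of right modules. -/
def CharLeft.map {R Y Z : Type*} [Ring R] [AddCommGroup Y] [Module Rᵐᵒᵖ Y] [AddCommGroup Z]
    [Module Rᵐᵒᵖ Z] (f : Y →ₗ[Rᵐᵒᵖ] Z) : CharLeft Z →ₗ[R] CharLeft Y where
  toFun φ := AddMonoidHom.comp (show Z →+ AddCircle (1 : ℚ) from φ) f.toAddMonoidHom
  map_add' _ _ := rfl
  map_smul' r φ := DFunLike.ext _ _ fun y => congrArg φ (f.map_smul (MulOpposite.op r) y).symm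

@[simp] theorem CharLeft.map_apply {R Y Z : Type*} [Ring R] [AddCommGroup Y] [Module Rᵐᵒᵖ Y]
    [AddCommGroup Z] [Module Rᵐᵒᵖ Z] (f : Y →ₗ[Rᵐᵒᵖ] Z) (φ : CharLeft Z) (y : Y) :
    CharLeft.map f φ y = φ (f y) := rfl

/-- The homomorphism of character modules induced by a homomorphism of left modules. -/
def CharRight.map {R X Z : Type*} [Ring R] [AddCommGroup X] [Module R X] [AddCommGroup Z]
    [Module R Z] (f : X →ₗ[R] Z) : CharRight Z →ₗ[Rᵐᵒᵖ] CharRight X where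
  toFun φ := AddMonoidHom.comp (show Z →+ AddCircle (1 : ℚ) from φ) f.toAddMonoidHom
  map_add' _ _ := rfl
  map_smul' r φ := DFunLike.ext _ _ fun y => congrArg φ (f.map_smul r.unop y).symm

theorem CharLeft.map_injective {R Y Z : Type*} [Ring R] [AddCommGroup Y] [Module Rᵐᵒᵖ Y]
    [AddCommGroup Z] [Module Rᵐᵒᵖ Z] {f : Y →ₗ[Rᵐᵒᵖ] Z} (hf : Function.Surjective f) :
    Function.Injective (CharLeft.map f) := fun φ ψ h => DFunLike.ext _ _ fun z => by
  obtain ⟨y, rfl⟩ := hf z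
  exact DFunLike.congr_fun h y

theorem CharRight.map_injective {R X Z : Type*} [Ring R] [AddCommGroup X] [Module R X]
    [AddCommGroup Z] [Module R Z] {f : X →ₗ[R] Z} (hf : Function.Surjective f) :
    Function.Injective (CharRight.map f) := fun φ ψ h => DFunLike.ext _ _ fun z => by
  obtain ⟨y, rfl⟩ := hf z
  exact DFunLike.congr_fun h y

theorem CharLeft.exact_map {R X Y Z : Type*} [Ring R] [AddCommGroup X] [Module Rᵐᵒᵖ X]
    [AddCommGroup Y] [Module Rᵐᵒᵖ Y] [AddCommGroup Z] [Module Rᵐᵒᵖ Z] {f : X →ₗ[Rᵐᵒᵖ] Y}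
    {g : Y →ₗ[Rᵐᵒᵖ] Z} (h : Function.Exact f g) :
    Function.Exact (CharLeft.map (R := R) g) (CharLeft.map f) := by
  intro φ
  constructor
  · intro hφ
    obtain ⟨χ, hχ⟩ := exists_character_factor g.toAddMonoidHom φ fun y hy => by
      obtain ⟨x, rfl⟩ := (h y).1 hy
      exact DFunLike.congr_fun hφ x
    exact ⟨χ, DFunLike.ext _ _ hχ⟩
  · rintro ⟨χ, rfl⟩
    refine DFunLike.ext _ _ fun x => ?_
    rw [CharLeft.map_apply, CharLeft.map_apply, h.apply_apply_eq_zero, map_zero]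
    rfl

theorem CharLeft.map_surjective {R Y Z : Type*} [Ring R] [AddCommGroup Y] [Module Rᵐᵒᵖ Y]
    [AddCommGroup Z] [Module Rᵐᵒᵖ Z] {f : Y →ₗ[Rᵐᵒᵖ] Z} (hf : Function.Injective f) :
    Function.Surjective (CharLeft.map f) := fun φ => by
  obtain ⟨χ, hχ⟩ := exists_character_factor f.toAddMonoidHom φ fun y hy => by
    rw [hf (hy.trans f.map_zero.symm)]
    exact map_zero φ
  exact ⟨χ, DFunLike.ext _ _ hχ⟩

theorem CharLeft.exists_ne_zero {Y : Type*} [AddCommGroup Y] {y : Y} (hy : y ≠ 0) :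
    ∃ φ : CharLeft Y, φ y ≠ 0 :=
  CharacterModule.exists_character_apply_ne_zero_of_ne_zero hy

/-- Isomorphic right modules have isomorphic character modules. -/
def CharLeft.congr {R Y Z : Type*} [Ring R] [AddCommGroup Y] [Module Rᵐᵒᵖ Y] [AddCommGroup Z]
    [Module Rᵐᵒᵖ Z] (e : Y ≃ₗ[Rᵐᵒᵖ] Z) : CharLeft Y ≃ₗ[R] CharLeft Z :=
  LinearEquiv.ofLinearMap (CharLeft.map e.symm.toLinearMap) (CharLeft.map e.toLinearMap)
    (LinearMap.ext fun φ => DFunLike.ext _ _ fun y => congrArg φ (e.apply_symm_apply y))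
    (LinearMap.ext fun φ => DFunLike.ext _ _ fun y => congrArg φ (e.symm_apply_apply y))

/-- Isomorphic left modules have isomorphic character modules. -/
def CharRight.congr {R Y Z : Type*} [Ring R] [AddCommGroup Y] [Module R Y] [AddCommGroup Z]
    [Module R Z] (e : Y ≃ₗ[R] Z) : CharRight Y ≃ₗ[Rᵐᵒᵖ] CharRight Z :=
  LinearEquiv.ofLinearMap (CharRight.map e.symm.toLinearMap) (CharRight.map e.toLinearMap)
    (LinearMap.ext fun φ => DFunLike.ext _ _ fun y => congrArg φ (e.apply_symm_apply y))
    (LinearMap.ext fun φ => DFunLike.ext _ _ fun y => congrArg φ (e.symm_apply_apply y))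

end Characters

/-! ### Tensor products over `R` and their characters. -/

namespace RTensor

variable {R B K L Y Z : Type*} [Ring R] [Ring B] [AddCommGroup K] [Module R K] [Module B K]
  [AddCommGroup L] [Module R L] [AddCommGroup Y] [Module Rᵐᵒᵖ Y] [AddCommGroup Z]

variable (R B) in
/-- The pure tensor `y ⊗ k`. -/
def tmul (k : K) (y : Y) : RTensor R B K Y := Submodule.Quotient.mk (k ⊗ₜ[ℤ] y)

theorem add_tmul (k k' : K) (y : Y) : tmul R B (k + k') y = tmul R B k y + tmul R B k' y :=
  congrArg Submodule.Quotient.mk (TensorProduct.add_tmul k k' y)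

theorem tmul_add (k : K) (y y' : Y) : tmul R B k (y + y') = tmul R B k y + tmul R B k y' :=
  congrArg Submodule.Quotient.mk (TensorProduct.tmul_add k y y')

theorem smul_tmul (r : R) (k : K) (y : Y) :
    tmul R B (r • k) y = tmul R B k (MulOpposite.op r • y) :=
  (Submodule.Quotient.eq _).2 (Submodule.subset_span ⟨r, k, y, rfl⟩)

/-- Tensoring with a fixed element of `K`. -/
def tmulLeft (B : Type*) [Ring B] [Module B K] (k : K) : Y →+ RTensor R B K Y :=
  AddMonoidHom.mk' (tmul R B k) (tmul_add k)

/-- Tensoring with a fixed element of `Y`. -/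
def tmulRight (B : Type*) [Ring B] [Module B K] (y : Y) : K →+ RTensor R B K Y :=
  AddMonoidHom.mk' (fun k => tmul R B k y) fun k k' => add_tmul k k' y

theorem tmul_sum {ι : Type*} (s : Finset ι) (k : K) (y : ι → Y) :
    tmul R B k (∑ i ∈ s, y i) = ∑ i ∈ s, tmul R B k (y i) :=
  map_sum (tmulLeft (R := R) B k) y s

theorem sum_tmul {ι : Type*} (s : Finset ι) (k : ι → K) (y : Y) :
    tmul R B (∑ i ∈ s, k i) y = ∑ i ∈ s, tmul R B (k i) y :=
  map_sum (tmulRight (R := R) B y) k s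

theorem zero_tmul (y : Y) : tmul R B (0 : K) y = 0 := map_zero (tmulRight (R := R) B y)

theorem tmul_zero (k : K) : tmul R B k (0 : Y) = 0 := map_zero (tmulLeft (R := R) B k)

theorem induction_on {p : RTensor R B K Y → Prop} (t : RTensor R B K Y) (h0 : p 0)
    (h1 : ∀ k y, p (tmul R B k y)) (h2 : ∀ s t, p s → p t → p (s + t)) : p t := by
  obtain ⟨t, rfl⟩ := Submodule.Quotient.mk_surjective _ t
  induction t using TensorProduct.induction_on with
  | zero => exact h0
  | tmul k y => exact h1 k y
  | add s t hs ht => exact h2 _ _ hs ht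

theorem addHom_ext {f g : RTensor R B K Y →+ Z}
    (h : ∀ k y, f (tmul R B k y) = g (tmul R B k y)) : f = g := by
  ext t
  induction t using induction_on with
  | h0 => simp
  | h1 k y => exact h k y
  | h2 s t hs ht => rw [map_add, map_add, hs, ht]

theorem exists_eq_sum {a : ℕ} {g : Fin a → K} (hg : ∀ k, ∃ r : Fin a → R, ∑ i, r i • g i = k)
    (t : RTensor R B K Y) : ∃ y : Fin a → Y, t = ∑ i, tmul R B (g i) (y i) := by
  induction t using induction_on with
  | h0 => exact ⟨0, by simp [tmul_zero]⟩
  | h1 k y =>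
    obtain ⟨r, rfl⟩ := hg k
    exact ⟨fun i => MulOpposite.op (r i) • y, by simp [sum_tmul, smul_tmul]⟩
  | h2 s t hs ht =>
    obtain ⟨y, rfl⟩ := hs
    obtain ⟨z, rfl⟩ := ht
    exact ⟨y + z, by simp [tmul_add, Finset.sum_add_distrib]⟩

variable [SMulCommClass R B K]

/-- The homomorphism on the tensor product given by a balanced biadditive map. -/
noncomputable def lift (φ : K →+ Y →+ Z)
    (h : ∀ (r : R) (k : K) (y : Y), φ (r • k) y = φ k (MulOpposite.op r • y)) :
    RTensor R B K Y →+ Z :=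
  (Submodule.liftQ ((tensorRelations R B K Y).restrictScalars ℤ)
    (TensorProduct.liftAddHom φ fun n k y => by simp).toIntLinearMap (by
      let ψ : K ⊗[ℤ] Y →+ Z := TensorProduct.liftAddHom φ fun n k y => by simp
      -- The relations form a `B`-span while `ψ` is only additive, so the induction needs the
      -- vanishing on all `B`-multiples.
      suffices H : ∀ t ∈ tensorRelations R B K Y, ∀ b : B, ψ (b • t) = 0 from fun t ht => by
        have := H t ht 1
        rwa [one_smul] at this
      intro t ht
      induction ht using Submodule.span_induction with
      | mem t ht =>
        obtain ⟨r, k, y, rfl⟩ := ht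
        intro b
        rw [smul_sub, TensorProduct.smul_tmul', TensorProduct.smul_tmul', map_sub,
          ← smul_comm r b k]
        exact sub_eq_zero.2 (h r (b • k) y)
      | zero => intro b; rw [smul_zero, map_zero]
      | add s t _ _ hs ht => intro b; rw [smul_add, map_add, hs, ht, add_zero]
      | smul c t _ ht => intro b; rw [smul_smul, ht])).toAddMonoidHom.comp
  (Submodule.Quotient.restrictScalarsEquiv ℤ (tensorRelations R B K Y)).symm.toAddMonoidHom

/-- A homomorphism from `K` to the character module of `Y` gives a character of the tensor
product. -/
noncomputable def character (f : K →ₗ[R] CharLeft Y) : RTensor R B K Y →+ AddCircle (1 : ℚ) :=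
  lift (AddMonoidHom.mk' (fun k => (show Y →+ AddCircle (1 : ℚ) from f k)) fun k k' => f.map_add k k')
    fun r k y => DFunLike.congr_fun (f.map_smul r k) y

@[simp] theorem character_tmul (f : K →ₗ[R] CharLeft Y) (k : K) (y : Y) :
    character (B := B) f (tmul R B k y) = f k y := rfl

end RTensor

namespace RTensor

variable {R B K L Y Z : Type*} [Ring R] [Ring B] [AddCommGroup K] [Module R K] [Module B K]
  [AddCommGroup L] [Module R L] [AddCommGroup Y] [Module Rᵐᵒᵖ Y] [AddCommGroup Z]

theorem sum_tmul_relations {a b : ℕ} {g : Fin a → K} {A : Fin b → Fin a → R}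
    (h : IsPresentation g A) (z : Fin b → Y) :
    ∑ i, tmul R B (g i) (∑ j, MulOpposite.op (A j i) • z j) = 0 := by
  simp_rw [tmul_sum, ← smul_tmul]
  rw [Finset.sum_comm]
  simp_rw [← sum_tmul, h.rel, zero_tmul, Finset.sum_const_zero]

/-- The vanishing criterion for elements of a tensor product with a finitely presented module. -/
theorem exists_of_sum_tmul_eq_zero [SMulCommClass R B K] {a b : ℕ} {g : Fin a → K}
    {A : Fin b → Fin a → R} (h : IsPresentation g A) (y : Fin a → Y)
    (hy : ∑ i, tmul R B (g i) (y i) = 0) :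
    ∃ z : Fin b → Y, ∀ i, y i = ∑ j, MulOpposite.op (A j i) • z j := by
  let T : (Fin b → Y) →+ (Fin a → Y) :=
    AddMonoidHom.mk' (fun z i => ∑ j, MulOpposite.op (A j i) • z j) fun z z' => by
      ext i
      simp [Finset.sum_add_distrib]
  -- Otherwise a character of `Y^a` kills the combinations of the relations but not `y`. Its
  -- components define a homomorphism `K → Y⁺`, that is, a character of the tensor product, nonzero
  -- on the given element.
  by_contra hne
  obtain ⟨χ, hχ, hχy⟩ := exists_character_of_notMem T.range (a := y) fun ⟨z, hz⟩ =>
    hne ⟨z, fun i => (congrFun hz i).symm⟩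
  let φ : Fin a → CharLeft Y := fun i => χ.comp (AddMonoidHom.single (fun _ => Y) i)
  have hφ : ∀ i y, φ i y = χ (Pi.single i y) := fun i y => rfl
  obtain ⟨f, hf⟩ := h.exists_linearMap φ fun j => by
    refine DFunLike.ext _ _ fun z => ?_
    simp only [CharLeft.sum_apply, CharLeft.smul_apply, hφ, CharLeft.zero_apply]
    rw [← map_sum]
    refine hχ _ ⟨Pi.single j z, ?_⟩
    ext i
    simp [T, Finset.sum_apply, Pi.single_apply]
  have := congrArg (character (B := B) f) hy
  simp only [map_sum, character_tmul, hf, hφ, map_zero] at this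
  rw [← map_sum, Finset.univ_sum_single] at this
  exact hχy this

/-- The homomorphism `X⁺ ⊗ K ⟶ Hom(K, X)⁺`, where `⁺` denotes character modules. -/
noncomputable def evalDual (B : Type*) [Ring B] [Module B K] [SMulCommClass R B K] (X : Type*)
    [AddCommGroup X] [Module R X] : RTensor R B K (CharRight X) →+ CharRight (K →ₗ[R] X) :=
  lift (AddMonoidHom.mk' (fun k => AddMonoidHom.mk' (fun φ : CharRight X =>
      (show CharRight (K →ₗ[R] X) from AddMonoidHom.mk' (fun f => φ (f k))
        fun f f' => map_add φ (f k) (f' k))) fun _ _ => rfl)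
      fun k k' => AddMonoidHom.ext fun φ => DFunLike.ext _ _ fun f =>
        (congrArg φ (f.map_add k k')).trans (map_add φ (f k) (f k')))
    fun r k φ => DFunLike.ext _ _ fun f => congrArg φ (f.map_smul r k)

@[simp] theorem evalDual_tmul [SMulCommClass R B K] {X : Type*} [AddCommGroup X] [Module R X] (k : K)
    (φ : CharRight X) (f : K →ₗ[R] X) : evalDual B X (tmul R B k φ) f = φ (f k) := rfl

/-- Evaluation at the generators embeds `Hom(K, X)` in `X^a`, and a character extends to `X^a`. -/
theorem evalDual_surjective [SMulCommClass R B K] {X : Type*} [AddCommGroup X] [Module R X]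
    {a b : ℕ} {g : Fin a → K} {A : Fin b → Fin a → R} (h : IsPresentation g A) :
    Function.Surjective (evalDual (R := R) (K := K) B X) := by
  intro ψ
  obtain ⟨χ, hχ⟩ := exists_character_hom h ψ
  refine ⟨∑ i, tmul R B (g i) (CharRight.of (χ i)), DFunLike.ext _ _ fun f => ?_⟩
  rw [map_sum, CharRight.sum_apply]
  exact (hχ f).symm

/-- An element `∑ g i ⊗ φ i` in the kernel gives a character of `X^a` vanishing on the solutions of
the relations of `K`. It is then a combination of these relations, which vanish in the tensor
product. -/
theorem evalDual_injective [SMulCommClass R B K] {X : Type*} [AddCommGroup X] [Module R X]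
    {a b : ℕ} {g : Fin a → K} {A : Fin b → Fin a → R} (h : IsPresentation g A) :
    Function.Injective (evalDual (R := R) (K := K) B X) := by
  rw [injective_iff_map_eq_zero]
  intro t ht
  obtain ⟨φ, rfl⟩ := exists_eq_sum h.span t
  obtain ⟨ψ, hψ⟩ := exists_character_relations A (fun i => (show X →+ _ from φ i)) fun x hx => by
    obtain ⟨f, hf⟩ := h.exists_linearMap x hx
    have := DFunLike.congr_fun ht f
    rw [map_sum, CharRight.sum_apply] at this
    simp only [evalDual_tmul, hf] at this
    exact this
  have hφ : ∀ i, φ i = ∑ j, MulOpposite.op (A j i) • CharRight.of (ψ j) :=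
    fun i => DFunLike.ext _ _ fun x => by
      rw [CharRight.sum_apply]
      exact hψ i x
  simp_rw [hφ]
  exact sum_tmul_relations h _

theorem exists_linearMap_of_character [SMulCommClass R B K]
    (χ : RTensor R B K Y →+ AddCircle (1 : ℚ)) :
    ∃ f : K →ₗ[R] CharLeft Y, ∀ k y, f k y = χ (tmul R B k y) :=
  ⟨{ toFun := fun k => CharLeft.of (χ.comp (tmulLeft B k))
     map_add' := fun k k' => DFunLike.ext _ _ fun y =>
        (congrArg χ (add_tmul k k' y)).trans (map_add χ _ _)
     map_smul' := fun r k => DFunLike.ext _ _ fun y => congrArg χ (smul_tmul r k y) },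
    fun _ _ => rfl⟩

end RTensor

/-! ### `fp_n`-injective and `fp_n`-flat modules: characters and products. -/

section Flat

variable {R : Type u} [Ring R] {n : ℕ}

/-- By adjunction `Hom(K, Y⁺) = (Y ⊗ K)⁺`, and a homomorphism of abelian groups is injective exactly
when its character dual is surjective. -/
theorem isFpFlatRight_iff_charLeft {Y : Type u} [AddCommGroup Y] [Module Rᵐᵒᵖ Y] :
    IsFpFlatRight R n Y ↔ IsFpInjective R n (CharLeft Y) := by
  constructor
  · intro h K L _ _ _ _ hK hL f hf g
    obtain ⟨χ, hχ⟩ := exists_character_factor (RTensor.map f Y).toAddMonoidHom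
      (RTensor.character (B := ℤ) g) fun t ht => by
        rw [h K L hK hL f hf (ht.trans (map_zero _).symm), map_zero]
    obtain ⟨g', hg'⟩ := RTensor.exists_linearMap_of_character χ
    refine ⟨g', LinearMap.ext fun k => DFunLike.ext _ _ fun y => ?_⟩
    exact (hg' _ _).trans (hχ (RTensor.tmul R ℤ k y))
  · intro h K L _ _ _ _ hK hL f hf
    rw [injective_iff_map_eq_zero]
    intro t ht
    by_contra hne
    obtain ⟨χ, hχ⟩ := CharacterModule.exists_character_apply_ne_zero_of_ne_zero hne
    obtain ⟨g, hg⟩ := RTensor.exists_linearMap_of_character (R := R) (B := ℤ) (K := K) (Y := Y) χ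
    obtain ⟨g', hg'⟩ := h K L hK hL f hf g
    refine hχ ?_
    have : (RTensor.character (B := ℤ) g').comp (RTensor.map f Y).toAddMonoidHom = χ :=
      RTensor.addHom_ext fun k y => by
        refine Eq.trans ?_ (hg k y)
        rw [← hg']
        rfl
    refine (DFunLike.congr_fun this t).symm.trans ?_
    change RTensor.character g' (RTensor.map f Y t) = 0
    rw [ht, map_zero]

/-- Since `K` is finitely presented, `X⁺ ⊗ K` embeds in `Hom(K, X)⁺`, where the dual of a surjective
restriction map is injective. For `L` naturality suffices. -/
theorem IsFpInjective.charRight (hn : 1 ≤ n) {X : Type u} [AddCommGroup X] [Module R X]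
    (h : IsFpInjective R n X) : IsFpFlatRight R n (CharRight X) := by
  intro K L _ _ _ _ hK hL f hf
  rw [injective_iff_map_eq_zero]
  intro t ht
  obtain ⟨a, b, g, A, hA⟩ := hK.exists_isPresentation hn
  refine (injective_iff_map_eq_zero _).1 (RTensor.evalDual_injective (B := ℤ) hA) t ?_
  refine DFunLike.ext _ _ fun φ => ?_
  obtain ⟨ψ, rfl⟩ := h K L hK hL f hf φ
  have key : ∀ t : RTensor R ℤ K (CharRight X), RTensor.evalDual ℤ X t (ψ.comp f) =
      RTensor.evalDual ℤ X (RTensor.map f _ t) ψ := by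
    intro t
    induction t using RTensor.induction_on with
    | h0 => simp
    | h1 k y => rfl
    | h2 s t hs ht => rw [map_add, map_add, map_add, CharRight.add_apply, CharRight.add_apply, hs, ht]
  refine (key t).trans ?_
  rw [ht, map_zero]
  rfl

theorem IsFpInjective.of_equiv {X X' : Type u} [AddCommGroup X] [Module R X] [AddCommGroup X']
    [Module R X'] (h : IsFpInjective R n X) (e : X ≃ₗ[R] X') : IsFpInjective R n X' := by
  intro K L _ _ _ _ hK hL f hf g
  obtain ⟨g', hg'⟩ := h K L hK hL f hf (e.symm.toLinearMap ∘ₗ g)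
  refine ⟨e.toLinearMap ∘ₗ g', LinearMap.ext fun k => ?_⟩
  exact (congrArg e (LinearMap.congr_fun hg' k)).trans (e.apply_symm_apply _)

theorem IsFpInjective.pi {ι : Type u} (X : ι → Type u) [∀ i, AddCommGroup (X i)]
    [∀ i, Module R (X i)] (h : ∀ i, IsFpInjective R n (X i)) : IsFpInjective R n (∀ i, X i) := by
  intro K L _ _ _ _ hK hL f hf g
  choose g' hg' using fun i => h i K L hK hL f hf (LinearMap.proj i ∘ₗ g)
  exact ⟨LinearMap.pi g', LinearMap.ext fun k => funext fun i => LinearMap.congr_fun (hg' i) k⟩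

/-- For finitely presented `K`, vanishing in `K ⊗ Y` is witnessed by finitely many elements indexed
by the relations; such witnesses can be chosen in each factor and assembled. -/
theorem IsFpFlatRight.pi (hn : 1 ≤ n) {ι : Type u} (Y : ι → Type u) [∀ i, AddCommGroup (Y i)]
    [∀ i, Module Rᵐᵒᵖ (Y i)] (h : ∀ i, IsFpFlatRight R n (Y i)) :
    IsFpFlatRight R n (∀ i, Y i) := by
  intro K L _ _ _ _ hK hL f hf
  rw [injective_iff_map_eq_zero]
  intro t ht
  obtain ⟨a, b, g, A, hA⟩ := hK.exists_isPresentation hn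
  obtain ⟨y, rfl⟩ := RTensor.exists_eq_sum hA.span t
  have key : ∀ l, ∑ i, RTensor.tmul R ℤ (g i) (y i l) = 0 := by
    intro l
    refine (injective_iff_map_eq_zero _).1 (h l K L hK hL f hf) _ ?_
    let π : RTensor R ℤ L (∀ i, Y i) →+ RTensor R ℤ L (Y l) :=
      RTensor.lift (AddMonoidHom.mk' (fun k => (RTensor.tmulLeft ℤ k).comp (Pi.evalAddMonoidHom Y l))
        fun k k' => AddMonoidHom.ext fun y => RTensor.add_tmul k k' (y l))
        fun r k y => RTensor.smul_tmul r k (y l)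
    have := congrArg π ht
    rw [map_zero, map_sum, map_sum] at this
    rw [map_sum]
    exact this
  choose z hz using fun l => RTensor.exists_of_sum_tmul_eq_zero hA _ (key l)
  have : y = fun i => ∑ j, MulOpposite.op (A j i) • fun l => z l j := by
    ext i l
    simpa [Finset.sum_apply] using hz l i
  rw [this]
  exact RTensor.sum_tmul_relations hA _

end Flat

/-! ### Pure homomorphisms. -/

section Pure

variable {R : Type u} [Ring R]

/-- A homomorphism is pure if finite systems of linear equations with constants in its source which
are solvable in its target are solvable in its source. -/
def IsPure {M H : Type*} [AddCommGroup M] [Module R M] [AddCommGroup H] [Module R H]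
    (ι : M →ₗ[R] H) : Prop :=
  ∀ (I J : Type) [Fintype I] [Fintype J] (Q : I → J → R) (m : I → M) (x : J → H),
    (∀ i, ∑ j, Q i j • x j = ι (m i)) → ∃ x' : J → M, ∀ i, ∑ j, Q i j • x' j = m i

theorem IsPure.injective {M H : Type*} [AddCommGroup M] [Module R M] [AddCommGroup H] [Module R H]
    {ι : M →ₗ[R] H} (h : IsPure ι) : Function.Injective ι := by
  rw [injective_iff_map_eq_zero]
  intro m hm
  -- The system of one equation in no unknowns, with constant `m`.
  obtain ⟨x, hx⟩ := h Unit Empty (fun _ => Empty.elim) (fun _ => m) Empty.elim (by simp [hm])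
  simpa using (hx ()).symm

/-- Extending `φ` to `L` is a finite linear system: the unknowns are the values at generators of
`L`, the equations are the relations of `L` and the values prescribed at generators of `K`. It is
solvable in `X`, hence in `X'`. -/
theorem IsPure.isFpInjective {n : ℕ} (hn : 1 ≤ n) {X X' : Type u} [AddCommGroup X] [Module R X]
    [AddCommGroup X'] [Module R X'] {ι : X' →ₗ[R] X} (h : IsPure ι) (hX : IsFpInjective R n X) :
    IsFpInjective R n X' := by
  intro K L _ _ _ _ hK hL f hf φ
  obtain ⟨ψ, hψ⟩ := hX K L hK hL f hf (ι ∘ₗ φ)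
  have hψ : ∀ k, ψ (f k) = ι (φ k) := LinearMap.congr_fun hψ
  obtain ⟨a, b, l, B, hl⟩ := hL.exists_isPresentation hn
  obtain ⟨s, t, k, A, hk⟩ := hK.exists_isPresentation hn
  choose q hq using fun p => hl.span (f (k p))
  obtain ⟨x, hx⟩ := h (Fin b ⊕ Fin s) (Fin a) (Sum.elim B q) (Sum.elim 0 fun p => φ (k p))
    (fun i => ψ (l i)) (by
      rintro (j | p)
      · simp only [Sum.elim_inl, ← map_smul, ← map_sum, hl.rel, map_zero, Pi.zero_apply]
      · simp only [Sum.elim_inr, ← map_smul, ← map_sum, hq, hψ])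
  obtain ⟨θ, hθ⟩ := hl.exists_linearMap x fun j => hx (Sum.inl j)
  refine ⟨θ, hk.hom_ext fun p => ?_⟩
  change θ (f (k p)) = φ (k p)
  rw [← hq, map_sum]
  refine Eq.trans ?_ (hx (Sum.inr p))
  simp [hθ]

/-- The canonical homomorphism of a left module to its double character module. -/
def doubleDual (R : Type u) [Ring R] (M : Type*) [AddCommGroup M] [Module R M] :
    M →ₗ[R] CharLeft (CharRight M) where
  toFun m := CharLeft.of (AddMonoidHom.mk' (fun φ : CharRight M => φ m) fun _ _ => rfl)
  map_add' m m' := DFunLike.ext _ _ fun φ : CharRight M => map_add φ m m'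
  map_smul' _ _ := rfl

@[simp] theorem doubleDual_apply {M : Type*} [AddCommGroup M] [Module R M] (m : M)
    (φ : CharRight M) : doubleDual R M m φ = φ m := rfl

/-- If `m` is not a right-hand side solvable in `M`, a character `χ` of `M^I` kills the solvable
ones but not `m`. Pairing a solution in the double dual with the components of `χ` gives `χ m = 0`.
-/
theorem isPure_doubleDual (M : Type*) [AddCommGroup M] [Module R M] : IsPure (doubleDual R M) := by
  classical
  intro I J _ _ Q m x hx
  let T : (J → M) →+ (I → M) :=
    AddMonoidHom.mk' (fun z i => ∑ j, Q i j • z j) fun z z' => by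
      ext i
      simp [Finset.sum_add_distrib]
  by_contra hne
  obtain ⟨χ, hχ, hχm⟩ := exists_character_of_notMem T.range (a := m) fun ⟨z, hz⟩ =>
    hne ⟨z, fun i => congrFun hz i⟩
  let φ : I → CharRight M := fun i => χ.comp (AddMonoidHom.single (fun _ => M) i)
  have hφ : ∀ i y, φ i y = χ (Pi.single i y) := fun i y => rfl
  have hφ0 : ∀ j, ∑ i, MulOpposite.op (Q i j) • φ i = 0 := by
    intro j
    refine DFunLike.ext _ _ fun z => ?_
    simp only [CharRight.sum_apply, CharRight.smul_apply, hφ, CharRight.zero_apply]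
    rw [← map_sum]
    refine hχ _ ⟨Pi.single j z, ?_⟩
    ext i
    simp [T, Finset.sum_apply, Pi.single_apply]
  refine hχm ?_
  calc χ m = ∑ i, φ i (m i) := by simp_rw [hφ]; rw [← map_sum, Finset.univ_sum_single]
    _ = ∑ i, ∑ j, x j (MulOpposite.op (Q i j) • φ i) := by
      refine Finset.sum_congr rfl fun i _ => ?_
      rw [← doubleDual_apply (R := R) (m i), ← hx, CharLeft.sum_apply]
      rfl
    _ = 0 := by
      rw [Finset.sum_comm]
      simp_rw [← map_sum, hφ0, map_zero, Finset.sum_const_zero]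

end Pure

/-! ### The functor `Hom(C, -)` on `fp_n`-injective modules. -/

section HomModule

variable {R C : Type u} [Ring R] [AddCommGroup C] [Module R C]
  {X Z : Type u} [AddCommGroup X] [Module R X] [AddCommGroup Z] [Module R Z]

instance : FunLike (HomModule R C R X) C X := inferInstanceAs (FunLike (C →ₗ[R] X) C X)

instance : LinearMapClass (HomModule R C R X) R C X :=
  inferInstanceAs (LinearMapClass (C →ₗ[R] X) R C X)

@[simp] theorem HomModule.add_apply (f f' : HomModule R C R X) (c : C) : (f + f') c = f c + f' c :=
  rfl

@[simp] theorem HomModule.sub_apply (f f' : HomModule R C R X) (c : C) : (f - f') c = f c - f' c :=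
  rfl

@[simp] theorem HomModule.zero_apply (c : C) : (0 : HomModule R C R X) c = 0 := rfl

@[simp] theorem HomModule.sum_apply {ι : Type*} (s : Finset ι) (f : ι → HomModule R C R X) (c : C) :
    (∑ i ∈ s, f i) c = ∑ i ∈ s, f i c :=
  map_sum (AddMonoidHom.mk' (fun f : HomModule R C R X => f c) fun _ _ => rfl) f s

variable [Module Rᵐᵒᵖ C] [SMulCommClass R Rᵐᵒᵖ C]

@[simp] theorem HomModule.smul_apply (r : R) (f : HomModule R C R X) (c : C) :
    (r • f) c = f (MulOpposite.op r • c) := rfl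

/-- Composition with a homomorphism `X ⟶ Z`. -/
def HomModule.map (C : Type u) [AddCommGroup C] [Module R C] [Module Rᵐᵒᵖ C]
    [SMulCommClass R Rᵐᵒᵖ C] (θ : X →ₗ[R] Z) : HomModule R C R X →ₗ[R] HomModule R C R Z where
  toFun f := θ.comp (show C →ₗ[R] X from f)
  map_add' f f' := DFunLike.ext _ _ fun c => θ.map_add (f c) (f' c)
  map_smul' _ _ := rfl

variable {n : ℕ} (hC : IsSemidualizing R R C) {a b : ℕ} {g : Fin a → C}
  {B : Fin b → Fin a → Rᵐᵒᵖ} (hP : IsPresentation g B)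

include hC hP

theorem IsSemidualizing.injective_pi_toSpanSingleton :
    Function.Injective (LinearMap.pi fun i => LinearMap.toSpanSingleton R C (g i)) := by
  rw [injective_iff_map_eq_zero]
  intro r hr
  have hr : ∀ i, r • g i = 0 := fun i => congrFun hr i
  refine hC.homothety_left.1 ?_
  ext c
  obtain ⟨s, rfl⟩ := hP.span c
  simp [hr]

/-- With `injective_pi_toSpanSingleton` this is exactness of `0 → R → C^a → C^b`, obtained by
applying `Hom_{R^op}(-, C)` to the presentation of `C` and identifying `End(C)` with `R`. -/
theorem IsSemidualizing.exists_smul_eq {v : Fin a → C} (hv : ∀ j, ∑ i, B j i • v i = 0) :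
    ∃ r : R, ∀ i, r • g i = v i := by
  obtain ⟨f, hf⟩ := hP.exists_linearMap v hv
  obtain ⟨r, rfl⟩ := hC.homothety_left.2 f
  exact ⟨r, hf⟩

/-- Surjectivity of evaluation `C ⊗ Hom(C, X) → X`: the map `R → X`, `1 ↦ x`, extends along `R →
C^a`, and the components of the extension are the required `f i`. -/
theorem IsSemidualizing.exists_eq_sum_apply (hX : IsFpInjective R n X) (x : X) :
    ∃ f : Fin a → HomModule R C R X, ∑ i, f i (g i) = x := by
  obtain ⟨f, hf⟩ := hX _ _ (finitelyNPresented_self n)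
    ((hC.resolution_left.finitelyNPresented n).pow a) _ (hC.injective_pi_toSpanSingleton hP)
    (LinearMap.toSpanSingleton R X x)
  refine ⟨fun i => f.comp (LinearMap.single R (fun _ => C) i), ?_⟩
  have := LinearMap.congr_fun hf 1
  simp only [LinearMap.comp_apply, LinearMap.toSpanSingleton_apply, one_smul] at this
  rw [← this, ← Finset.univ_sum_single (LinearMap.pi _ _), map_sum]
  refine Finset.sum_congr rfl fun i _ => ?_
  change f (Pi.single i (g i)) = f (Pi.single i ((1 : R) • g i))
  rw [one_smul]

/-- Injectivity of evaluation `C ⊗ Hom(C, X) → X`: the map `C^a → X` with components `f i` kills the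
image of `R`, so it extends along the embedding of `C^a / R` into `C^b`, whose source is again
finitely `n`-presented. -/
theorem IsSemidualizing.exists_of_sum_apply_eq_zero (hX : IsFpInjective R n X)
    (f : Fin a → HomModule R C R X) (hf : ∑ i, f i (g i) = 0) :
    ∃ h : Fin b → HomModule R C R X, ∀ i, f i = ∑ j, (B j i).unop • h j := by
  have hCn := hC.resolution_left.finitelyNPresented n
  let ι : R →ₗ[R] (Fin a → C) := LinearMap.pi fun i => LinearMap.toSpanSingleton R C (g i)
  have hι : Function.Injective ι := hC.injective_pi_toSpanSingleton hP
  have hιr : ∀ r i, ι r i = r • g i := fun _ _ => rfl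
  let β : (Fin a → C) →ₗ[R] (Fin b → C) :=
    { toFun := fun v j => ∑ i, B j i • v i
      map_add' := fun v w => by ext j; simp [Finset.sum_add_distrib]
      map_smul' := fun r v => by ext j; simp [Finset.smul_sum, smul_comm r] }
  have hβ : ∀ v j, β v j = ∑ i, B j i • v i := fun _ _ => rfl
  have hker : LinearMap.ker β = LinearMap.range ι := by
    ext v
    constructor
    · intro hv
      obtain ⟨r, hr⟩ := hC.exists_smul_eq hP (fun j => congrFun (LinearMap.mem_ker.1 hv) j)
      exact ⟨r, funext hr⟩
    · rintro ⟨r, rfl⟩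
      ext j
      rw [hβ]
      simp_rw [hιr, ← smul_comm r, ← Finset.smul_sum, hP.rel, smul_zero]
      rfl
  let F : (Fin a → C) →ₗ[R] X := LinearMap.lsum R _ ℕ fun i => (show C →ₗ[R] X from f i)
  have hF : ∀ v, F v = ∑ i, f i (v i) := fun v => by
    simp only [F, LinearMap.lsum_apply, LinearMap.sum_apply]
    rfl
  have hFι : LinearMap.range ι ≤ LinearMap.ker F := by
    rintro _ ⟨r, rfl⟩
    rw [LinearMap.mem_ker, hF]
    simp_rw [hιr, map_smul, ← Finset.smul_sum, hf, smul_zero]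
  obtain ⟨h, hh⟩ := hX _ _ ((finitelyNPresented_self n).quotient_range (hCn.pow a) ι hι)
    (hCn.pow b) ((LinearMap.range ι).liftQ β hker.ge) (by
      rw [← LinearMap.ker_eq_bot]
      exact Submodule.ker_liftQ_eq_bot _ _ _ hker.le) ((LinearMap.range ι).liftQ F hFι)
  have hh' : ∀ v, h (β v) = F v := fun v => LinearMap.congr_fun hh (Submodule.Quotient.mk v)
  refine ⟨fun j => h.comp (LinearMap.single R (fun _ => C) j), fun i => DFunLike.ext _ _ fun c => ?_⟩
  have e1 : F (Pi.single i c) = f i c := by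
    rw [hF, Finset.sum_eq_single i, Pi.single_eq_same]
    · intro j _ hj
      rw [Pi.single_eq_of_ne hj, map_zero]
    · simp
  have e2 : β (Pi.single i c) = fun j => B j i • c := by
    ext j
    rw [hβ, Finset.sum_eq_single i, Pi.single_eq_same]
    · intro j _ hj
      rw [Pi.single_eq_of_ne hj, smul_zero]
    · simp
  rw [← e1, ← hh', e2, ← Finset.univ_sum_single (fun j => B j i • c), map_sum, HomModule.sum_apply]
  rfl

/-- The functor `Hom(C, -)` is full on homomorphisms from `Hom(C, X)` for `X` injective relative to
finitely `n`-presented modules. -/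
theorem IsSemidualizing.exists_map_eq (hX : IsFpInjective R n X)
    (φ : HomModule R C R X →ₗ[R] HomModule R C R Z) : ∃ θ : X →ₗ[R] Z, φ = HomModule.map C θ := by
  let p : (Fin a → HomModule R C R X) →+ X := AddMonoidHom.mk' (fun f => ∑ i, f i (g i))
    fun f f' => by simp [Finset.sum_add_distrib]
  let q : (Fin a → HomModule R C R X) →+ Z := AddMonoidHom.mk' (fun f => ∑ i, φ (f i) (g i))
    fun f f' => by simp [Finset.sum_add_distrib]
  have hp : Function.Surjective p := hC.exists_eq_sum_apply hP hX
  -- This makes `∑ f i (g i) ↦ ∑ φ (f i) (g i)` a well-defined map on `X`: an expression of zero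
  -- comes from the relations of `C`, which `φ` respects.
  have hpq : p.ker ≤ q.ker := by
    intro f hf
    obtain ⟨h, hh⟩ := hC.exists_of_sum_apply_eq_zero hP hX f hf
    change ∑ i, φ (f i) (g i) = 0
    simp_rw [hh, map_sum, HomModule.sum_apply, map_smul, HomModule.smul_apply, MulOpposite.op_unop]
    rw [Finset.sum_comm]
    simp_rw [← map_sum, hP.rel, map_zero, Finset.sum_const_zero]
  let θ : X →+ Z := AddMonoidHom.liftOfRightInverse p (Function.surjInv hp)
    (Function.rightInverse_surjInv hp) ⟨q, hpq⟩
  have hθ : ∀ f, θ (p f) = q f := AddMonoidHom.liftOfRightInverse_comp_apply p _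
    (Function.rightInverse_surjInv hp) ⟨q, hpq⟩
  have hθ' : ∀ f c, θ (f c) = φ f c := by
    intro f c
    obtain ⟨s, rfl⟩ := hP.span c
    have := hθ fun i => (s i).unop • f
    simpa [p, q] using this
  refine ⟨{ θ with map_smul' := fun r x => ?_ }, LinearMap.ext fun f => DFunLike.ext _ _ fun c =>
    (hθ' f c).symm⟩
  obtain ⟨f, rfl⟩ := hC.exists_eq_sum_apply hP hX x
  change θ (r • _) = r • θ _
  rw [Finset.smul_sum, map_sum, map_sum, Finset.smul_sum]
  simp_rw [← map_smul, hθ', ← map_smul]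

end HomModule

section

variable {R : Type u} [Ring R]

theorem IsPure.comp_equiv {M H H' : Type*} [AddCommGroup M] [Module R M] [AddCommGroup H]
    [Module R H] [AddCommGroup H'] [Module R H'] {ι : M →ₗ[R] H} (h : IsPure ι) (e : H ≃ₗ[R] H') :
    IsPure (e.toLinearMap ∘ₗ ι) := by
  intro I J _ _ Q m x hx
  refine h I J Q m (fun j => e.symm (x j)) fun i => e.injective ?_
  simpa using hx i

/-- A solution in the product is cut down to the finite union of the supports of the constants;
elsewhere zero is a solution. -/
theorem isPure_coeFnLinearMap {ι : Type*} (M : ι → Type*) [∀ i, AddCommGroup (M i)]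
    [∀ i, Module R (M i)] :
    IsPure (DFinsupp.coeFnLinearMap R : (Π₀ i, M i) →ₗ[R] ∀ i, M i) := by
  classical
  intro I J _ _ Q m x hx
  let S : Finset ι := Finset.univ.biUnion fun i => (m i).support
  refine ⟨fun j => DFinsupp.mk S fun t => x j t, fun i => ?_⟩
  ext t
  have := congrFun (hx i) t
  simp only [Finset.sum_apply, Pi.smul_apply, DFinsupp.coeFnLinearMap_apply] at this
  simp only [DFinsupp.finsetSum_apply, DFinsupp.smul_apply, DFinsupp.mk_apply]
  by_cases ht : t ∈ S
  · simpa [ht] using this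
  · have hm : m i t = 0 := by
      by_contra hne
      exact ht (Finset.mem_biUnion.2 ⟨i, Finset.mem_univ i, DFinsupp.mem_support_iff.2 hne⟩)
    simp [ht, hm]

end

/-! ### Closure of `Cfp_nI(R)` under products, pure submodules and direct sums. -/

section Classes

variable {R C : Type u} [Ring R] [AddCommGroup C] [Module R C] [Module Rᵐᵒᵖ C]
  [SMulCommClass R Rᵐᵒᵖ C] {n : ℕ}

theorem CfpInjective.of_equiv {M N : Type u} [AddCommGroup M] [Module R M] [AddCommGroup N]
    [Module R N] (h : CfpInjective R R C n (ModuleCat.of R M)) (e : M ≃ₗ[R] N) :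
    CfpInjective R R C n (ModuleCat.of R N) := by
  obtain ⟨X, hX, ⟨f⟩⟩ := h
  exact ⟨X, hX, ⟨e.symm.trans f⟩⟩

theorem CfpInjective.pi {ι : Type u} (M : ι → Type u) [∀ i, AddCommGroup (M i)]
    [∀ i, Module R (M i)] (h : ∀ i, CfpInjective R R C n (ModuleCat.of R (M i))) :
    CfpInjective R R C n (ModuleCat.of R (∀ i, M i)) := by
  choose X hX e using h
  have e i := (e i).some
  let F : (∀ i, M i) →ₗ[R] HomModule R C R (∀ i, X i) :=
    { toFun := fun m => LinearMap.pi fun i => (show C →ₗ[R] X i from e i (m i))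
      map_add' := fun m m' => DFunLike.ext _ _ fun c => funext fun i =>
        DFunLike.congr_fun ((e i).map_add (m i) (m' i)) c
      map_smul' := fun r m => DFunLike.ext _ _ fun c => funext fun i =>
        DFunLike.congr_fun ((e i).map_smul r (m i)) c }
  refine ⟨ModuleCat.of R (∀ i, X i), IsFpInjective.pi _ hX, ⟨LinearEquiv.ofBijective F ⟨?_, ?_⟩⟩⟩
  · intro m m' h
    refine funext fun i => (e i).injective (DFunLike.ext _ _ fun c => ?_)
    exact congrFun (DFunLike.congr_fun h c) i
  · intro f
    refine ⟨fun i => (e i).symm (LinearMap.proj i ∘ₗ (show C →ₗ[R] _ from f)),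
      DFunLike.ext _ _ fun c => funext fun i => ?_⟩
    exact DFunLike.congr_fun ((e i).apply_symm_apply _) c

/-- The submodule `X'` generated by the values of `M` is the image of `C ⊗ M`. Linear systems over
`X` are translated, through `X ≅ C ⊗ Hom(C, X)`, into systems over `Hom(C, X)` and solved in `M` by
purity. This gives both that `X'` is pure in `X` and that `M` is all of `Hom(C, X')`. -/
theorem CfpInjective.of_isPure_homModule (hC : IsSemidualizing R R C) (hn : 1 ≤ n) {M X : Type u}
    [AddCommGroup M] [Module R M] [AddCommGroup X] [Module R X] (hX : IsFpInjective R n X)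
    (ι : M →ₗ[R] HomModule R C R X) (hι : IsPure ι) :
    CfpInjective R R C n (ModuleCat.of R M) := by
  classical
  obtain ⟨a, b, g, B, hP⟩ :=
    (hC.resolution_right.finitelyNPresented 1).exists_isPresentation le_rfl
  let X' : Submodule R X := Submodule.span R {x | ∃ m c, x = ι m c}
  have hmem : ∀ m c, ι m c ∈ X' := fun m c => Submodule.subset_span ⟨m, c, rfl⟩
  have happ : ∀ (f : HomModule R C R X) (s : Fin a → Rᵐᵒᵖ),
      f (∑ i, s i • g i) = ∑ i, ((s i).unop • f) (g i) := fun f s => by simp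
  have hX' : ∀ x ∈ X', ∃ m : Fin a → M, ∑ i, ι (m i) (g i) = x := by
    intro x hx
    have hgen : ∀ m c, ∃ m' : Fin a → M, ∑ i, ι (m' i) (g i) = ι m c := fun m c => by
      obtain ⟨s, rfl⟩ := hP.span c
      exact ⟨fun i => (s i).unop • m, by rw [happ]; simp⟩
    have hadd : ∀ x y : X, (∃ m : Fin a → M, ∑ i, ι (m i) (g i) = x) →
        (∃ m : Fin a → M, ∑ i, ι (m i) (g i) = y) →
        ∃ m : Fin a → M, ∑ i, ι (m i) (g i) = x + y := by
      rintro _ _ ⟨m, rfl⟩ ⟨m', rfl⟩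
      exact ⟨m + m', by simp [Finset.sum_add_distrib]⟩
    induction hx using Submodule.span_induction with
    | mem x hx =>
      obtain ⟨m, c, rfl⟩ := hx
      exact hgen m c
    | zero => exact ⟨0, by simp⟩
    | add x y _ _ hx hy => exact hadd x y hx hy
    | smul r x _ hx =>
      obtain ⟨m, rfl⟩ := hx
      rw [Finset.smul_sum]
      refine Finset.sum_induction _ (fun x => ∃ m : Fin a → M, ∑ i, ι (m i) (g i) = x) hadd
        ⟨0, by simp⟩ fun i _ => ?_
      rw [← map_smul]
      exact hgen _ _
  have hpure : IsPure X'.subtype := by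
    intro I J _ _ Q x' x hx
    choose m hm using fun k => hX' (x' k) (x' k).2
    choose h hh using fun l => hC.exists_eq_sum_apply hP hX (x l)
    choose s hs using fun k l i => hP.span (Q k l • g i)
    have hQ : ∀ (k : I) (l : J) (f : Fin a → HomModule R C R X),
        ∑ p, ∑ i, ((s k l i p).unop • f i) (g p) = Q k l • ∑ i, f i (g i) := by
      intro k l f
      rw [Finset.sum_comm, Finset.smul_sum]
      refine Finset.sum_congr rfl fun i _ => ?_
      rw [← map_smul, ← hs, happ]
    have hzero : ∀ k, ∑ p, (∑ l, ∑ i, (s k l i p).unop • h l i - ι (m k p)) (g p) = 0 := by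
      intro k
      simp only [HomModule.sub_apply, HomModule.sum_apply, Finset.sum_sub_distrib, hm]
      rw [Finset.sum_comm]
      simp_rw [hQ, hh]
      exact sub_eq_zero.2 (hx k)
    choose w hw using fun k => hC.exists_of_sum_apply_eq_zero hP hX _ (hzero k)
    -- The unknowns are the components `h` of the solution and the correction terms `w`, which
    -- record that equality after evaluation at the `g p` holds only modulo the relations of `C`.
    -- The conditional gives each equation `k` its own corrections; they vanish on evaluating back.
    obtain ⟨z, hz⟩ := hι (I × Fin a) ((J × Fin a) ⊕ (I × Fin b))
      (fun kp => Sum.elim (fun li => (s kp.1 li.1 li.2 kp.2).unop)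
        fun kj => if kj.1 = kp.1 then -(B kj.2 kp.2).unop else 0)
      (fun kp => m kp.1 kp.2) (Sum.elim (fun li => h li.1 li.2) fun kj => w kj.1 kj.2) (by
        rintro ⟨k, p⟩
        have := hw k p
        rw [sub_eq_iff_eq_add] at this
        simp only [Fintype.sum_sum_type, Sum.elim_inl, Sum.elim_inr, Fintype.sum_prod_type, this,
          ite_smul, zero_smul, neg_smul]
        rw [Finset.sum_eq_single k]
        · simp
        · intro k' _ hk'
          simp [hk']
        · simp)
    refine ⟨fun l => ∑ i, ⟨ι (z (Sum.inl (l, i))) (g i), hmem _ _⟩, fun k => Subtype.ext ?_⟩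
    have hz' : ∀ p, m k p = ∑ l, ∑ i, (s k l i p).unop • z (Sum.inl (l, i)) -
        ∑ j, (B j p).unop • z (Sum.inr (k, j)) := by
      intro p
      rw [← hz (k, p)]
      simp only [Fintype.sum_sum_type, Sum.elim_inl, Sum.elim_inr, Fintype.sum_prod_type,
        ite_smul, zero_smul, neg_smul]
      rw [sub_eq_add_neg, Finset.sum_eq_single k]
      · simp
      · intro k' _ hk'
        simp [hk']
      · simp
    have hrel : ∑ p, (∑ j, (B j p).unop • ι (z (Sum.inr (k, j)))) (g p) = 0 := by
      simp only [HomModule.sum_apply, HomModule.smul_apply, MulOpposite.op_unop]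
      rw [Finset.sum_comm]
      simp_rw [← map_sum, hP.rel, map_zero, Finset.sum_const_zero]
    rw [← hm k]
    simp_rw [hz', map_sub, map_sum, map_smul, HomModule.sub_apply, Finset.sum_sub_distrib]
    rw [hrel, sub_zero]
    simp only [HomModule.sum_apply]
    rw [Finset.sum_comm]
    simp_rw [hQ]
    simp
  let F : M →ₗ[R] HomModule R C R X' :=
    { toFun := fun m => LinearMap.codRestrict X' (show C →ₗ[R] X from ι m) (hmem m)
      map_add' := fun m m' => DFunLike.ext _ _ fun c => Subtype.ext
        (DFunLike.congr_fun (ι.map_add m m') c)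
      map_smul' := fun r m => DFunLike.ext _ _ fun c => Subtype.ext
        (DFunLike.congr_fun (ι.map_smul r m) c) }
  refine ⟨ModuleCat.of R X', hpure.isFpInjective hn hX, ⟨LinearEquiv.ofBijective F ⟨?_, ?_⟩⟩⟩
  · intro m m' h
    refine hι.injective (DFunLike.ext _ _ fun c => ?_)
    exact congrArg Subtype.val (DFunLike.congr_fun h c)
  · intro φ'
    let φ : HomModule R C R X := X'.subtype ∘ₗ (show C →ₗ[R] X' from φ')
    have hφ : ∀ c, φ c = φ' c := fun _ => rfl
    obtain ⟨a', b', d, D, hD⟩ :=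
      (hC.resolution_left.finitelyNPresented 1).exists_isPresentation le_rfl
    choose m hm using fun k => hX' (φ (d k)) (φ' (d k)).2
    choose r hr using fun k => hP.span (d k)
    have hzero : ∀ k, ∑ p, ((r k p).unop • φ - ι (m k p)) (g p) = 0 := by
      intro k
      simp only [HomModule.sub_apply, Finset.sum_sub_distrib, hm]
      rw [← happ, hr, sub_self]
    choose w hw using fun k => hC.exists_of_sum_apply_eq_zero hP hX _ (hzero k)
    -- Here the only unknown besides the corrections is `φ` itself; the equations prescribe its
    -- values at the left generators `d k` of `C`, so the solution found in `M` must map to `φ`.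
    obtain ⟨z, hz⟩ := hι (Fin a' × Fin a) (Unit ⊕ (Fin a' × Fin b))
      (fun kp => Sum.elim (fun _ => (r kp.1 kp.2).unop)
        fun kj => if kj.1 = kp.1 then -(B kj.2 kp.2).unop else 0)
      (fun kp => m kp.1 kp.2) (Sum.elim (fun _ => φ) fun kj => w kj.1 kj.2) (by
        rintro ⟨k, p⟩
        have := hw k p
        rw [sub_eq_iff_eq_add] at this
        simp only [Fintype.sum_sum_type, Sum.elim_inl, Sum.elim_inr, Fintype.sum_prod_type,
          Finset.univ_unique, Finset.sum_singleton, this, ite_smul, zero_smul, neg_smul]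
        rw [Finset.sum_eq_single k]
        · simp
        · intro k' _ hk'
          simp [hk']
        · simp)
    have hz' : ∀ k p, m k p = (r k p).unop • z (Sum.inl ()) -
        ∑ j, (B j p).unop • z (Sum.inr (k, j)) := by
      intro k p
      rw [← hz (k, p)]
      simp only [Fintype.sum_sum_type, Sum.elim_inl, Sum.elim_inr, Fintype.sum_prod_type,
        Finset.univ_unique, Finset.sum_singleton, ite_smul, zero_smul, neg_smul]
      rw [sub_eq_add_neg, Finset.sum_eq_single k]
      · simp
      · intro k' _ hk'
        simp [hk']
      · simp
    have hrel : ∀ k, ∑ p, (∑ j, (B j p).unop • ι (z (Sum.inr (k, j)))) (g p) = 0 := by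
      intro k
      simp only [HomModule.sum_apply, HomModule.smul_apply, MulOpposite.op_unop]
      rw [Finset.sum_comm]
      simp_rw [← map_sum, hP.rel, map_zero, Finset.sum_const_zero]
    have hfin : (show C →ₗ[R] X from ι (z (Sum.inl ()))) = (show C →ₗ[R] X from φ) := by
      refine hD.hom_ext fun k => ?_
      change ι (z (Sum.inl ())) (d k) = φ (d k)
      rw [← hm k]
      simp_rw [hz', map_sub, map_sum, map_smul, HomModule.sub_apply, Finset.sum_sub_distrib]
      rw [hrel, sub_zero, ← happ, hr]
    exact ⟨z (Sum.inl ()), DFunLike.ext _ _ fun c => Subtype.ext (LinearMap.congr_fun hfin c)⟩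

theorem CfpInjective.of_isPure (hC : IsSemidualizing R R C) (hn : 1 ≤ n) {M N : Type u}
    [AddCommGroup M] [Module R M] [AddCommGroup N] [Module R N]
    (h : CfpInjective R R C n (ModuleCat.of R N)) (ι : M →ₗ[R] N) (hι : IsPure ι) :
    CfpInjective R R C n (ModuleCat.of R M) := by
  obtain ⟨X, hX, ⟨e⟩⟩ := h
  exact CfpInjective.of_isPure_homModule hC hn hX _ (hι.comp_equiv e)

theorem CfpInjective.dfinsupp (hC : IsSemidualizing R R C) (hn : 1 ≤ n) {ι : Type u}
    (M : ι → Type u) [∀ i, AddCommGroup (M i)] [∀ i, Module R (M i)]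
    (h : ∀ i, CfpInjective R R C n (ModuleCat.of R (M i))) :
    CfpInjective R R C n (ModuleCat.of R (Π₀ i, M i)) :=
  (CfpInjective.pi M h).of_isPure hC hn _ (isPure_coeFnLinearMap M)

end Classes

/-- An additive map on a tensor product which is equivariant on pure tensors is linear. -/
def RTensor.toLinearMap {R B K Y Z : Type*} [Ring R] [Ring B] [AddCommGroup K] [Module R K]
    [Module B K] [AddCommGroup Y] [Module Rᵐᵒᵖ Y] [AddCommGroup Z] [Module B Z]
    (f : RTensor R B K Y →+ Z) (h : ∀ (b : B) (k : K) (y : Y), f (RTensor.tmul R B (b • k) y) =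
      b • f (RTensor.tmul R B k y)) :
    RTensor R B K Y →ₗ[B] Z where
  toFun := f
  map_add' := f.map_add
  map_smul' b t := by
    induction t using RTensor.induction_on with
    | h0 => simp
    | h1 k y => exact h b k y
    | h2 s t hs ht =>
      rw [smul_add, map_add, hs, ht, map_add]
      exact (smul_add b (f s) (f t)).symm

/-! ### Characters exchange `Cfp_nI(R)` and `Cfp_nF(R^op)`. -/

section Duality

variable {R C : Type u} [Ring R] [AddCommGroup C] [Module R C] [Module Rᵐᵒᵖ C]

theorem CfpFlatRight.of_equiv {n : ℕ} {M N : Type u} [AddCommGroup M] [Module Rᵐᵒᵖ M]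
    [AddCommGroup N] [Module Rᵐᵒᵖ N] (h : CfpFlatRight R R C n (ModuleCat.of Rᵐᵒᵖ M))
    (e : M ≃ₗ[Rᵐᵒᵖ] N) : CfpFlatRight R R C n (ModuleCat.of Rᵐᵒᵖ N) := by
  obtain ⟨X, hX, ⟨f⟩⟩ := h
  exact ⟨X, hX, ⟨e.symm.trans f⟩⟩

variable [SMulCommClass R Rᵐᵒᵖ C] {n : ℕ}

theorem CfpInjective.charRight (hC : IsSemidualizing R R C) (hn : 1 ≤ n) {M : Type u}
    [AddCommGroup M] [Module R M] (h : CfpInjective R R C n (ModuleCat.of R M)) :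
    CfpFlatRight R R C n (ModuleCat.of Rᵐᵒᵖ (CharRight M)) := by
  obtain ⟨X, hX, ⟨e⟩⟩ := h
  obtain ⟨a, b, g, A, hP⟩ :=
    (hC.resolution_left.finitelyNPresented 1).exists_isPresentation le_rfl
  let τ : RTensor R Rᵐᵒᵖ C (CharRight X) →ₗ[Rᵐᵒᵖ] CharRight (HomModule R C R X) :=
    RTensor.toLinearMap (show _ →+ CharRight (HomModule R C R X) from RTensor.evalDual Rᵐᵒᵖ X)
      fun _ _ _ => rfl
  let E := LinearEquiv.ofBijective τ
    ⟨RTensor.evalDual_injective (B := Rᵐᵒᵖ) hP, RTensor.evalDual_surjective (B := Rᵐᵒᵖ) hP⟩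
  exact ⟨ModuleCat.of _ (CharRight X), hX.charRight hn, ⟨(CharRight.congr e).trans E.symm⟩⟩

theorem CfpFlatRight.charLeft {N : Type u} [AddCommGroup N] [Module Rᵐᵒᵖ N]
    (h : CfpFlatRight R R C n (ModuleCat.of Rᵐᵒᵖ N)) :
    CfpInjective R R C n (ModuleCat.of R (CharLeft N)) := by
  obtain ⟨Y, hY, ⟨e⟩⟩ := h
  let Ψ : CharLeft (RTensor R Rᵐᵒᵖ C Y) →ₗ[R] HomModule R C R (CharLeft Y) :=
    { toFun := fun χ =>
        { toFun := fun c => CharLeft.of (AddMonoidHom.mk' (fun y => χ (RTensor.tmul R Rᵐᵒᵖ c y))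
            fun y y' => (congrArg χ (RTensor.tmul_add c y y')).trans (map_add χ _ _))
          map_add' := fun c c' => DFunLike.ext _ _ fun y =>
            (congrArg χ (RTensor.add_tmul c c' y)).trans (map_add χ _ _)
          map_smul' := fun r c => DFunLike.ext _ _ fun y => congrArg χ (RTensor.smul_tmul r c y) }
      map_add' := fun _ _ => rfl
      map_smul' := fun _ _ => rfl }
  have hΨ : ∀ χ c y, Ψ χ c y = χ (RTensor.tmul R Rᵐᵒᵖ c y) := fun _ _ _ => rfl
  refine ⟨ModuleCat.of R (CharLeft Y), isFpFlatRight_iff_charLeft.1 hY,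
    ⟨(CharLeft.congr e).trans (LinearEquiv.ofBijective Ψ ⟨?_, ?_⟩)⟩⟩
  · intro χ χ' h
    refine RTensor.addHom_ext (f := χ) (g := χ') fun c y => ?_
    exact (hΨ χ c y).symm.trans ((congrArg (fun f => f c y) h).trans (hΨ χ' c y))
  · intro f
    exact ⟨RTensor.character (R := R) f, DFunLike.ext _ _ fun c => DFunLike.ext _ _ fun y => hΨ _ c y⟩

/-- The right module `Hom(C, N)` for a right module `N`, with `(f s)(c) = f (s c)`. -/
def HomRight (R C N : Type*) [Ring R] [AddCommGroup C] [Module Rᵐᵒᵖ C] [AddCommGroup N]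
    [Module Rᵐᵒᵖ N] : Type _ := C →ₗ[Rᵐᵒᵖ] N

section

variable {N : Type*} [AddCommGroup N] [Module Rᵐᵒᵖ N]

instance : AddCommGroup (HomRight R C N) := inferInstanceAs (AddCommGroup (C →ₗ[Rᵐᵒᵖ] N))

instance : FunLike (HomRight R C N) C N := inferInstanceAs (FunLike (C →ₗ[Rᵐᵒᵖ] N) C N)

instance : LinearMapClass (HomRight R C N) Rᵐᵒᵖ C N :=
  inferInstanceAs (LinearMapClass (C →ₗ[Rᵐᵒᵖ] N) Rᵐᵒᵖ C N)

instance : Module Rᵐᵒᵖ (HomRight R C N) where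
  smul s f := LinearMap.comp (show C →ₗ[Rᵐᵒᵖ] N from f) (Module.toModuleEnd Rᵐᵒᵖ C s.unop)
  one_smul f := DFunLike.ext _ _ fun c => congrArg f (one_smul R c)
  mul_smul r s f := DFunLike.ext _ _ fun c => congrArg f (mul_smul s.unop r.unop c)
  smul_zero _ := LinearMap.zero_comp _
  smul_add _ _ _ := LinearMap.add_comp _ _ _
  add_smul r s f := DFunLike.ext _ _ fun c =>
    (congrArg f (add_smul r.unop s.unop c)).trans (map_add f _ _)
  zero_smul f := DFunLike.ext _ _ fun c => (congrArg f (zero_smul R c)).trans (map_zero f)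

end

/-- With `Y = Hom(C, N)`, one has `X ≅ C ⊗ Hom(C, X) ≅ C ⊗ N⁺ ≅ Y⁺`, so `Y` is `fp_n`-flat. The
evaluation `Y ⊗ C → N` is an isomorphism because its character dual is one. -/
theorem CfpFlatRight.of_charLeft (hC : IsSemidualizing R R C) {N : Type u} [AddCommGroup N]
    [Module Rᵐᵒᵖ N] (h : CfpInjective R R C n (ModuleCat.of R (CharLeft N))) :
    CfpFlatRight R R C n (ModuleCat.of Rᵐᵒᵖ N) := by
  obtain ⟨X, hX, ⟨e⟩⟩ := h
  obtain ⟨a, b, g, B, hP⟩ :=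
    (hC.resolution_right.finitelyNPresented 1).exists_isPresentation le_rfl
  -- The dual `N⁺ → (Y ⊗ C)⁺ = Hom(C, Y⁺)` of evaluation, transported along `e`; by fullness it
  -- comes from some `θ : X → Y⁺`.
  let φ : HomModule R C R X →ₗ[R] HomModule R C R (CharLeft (HomRight R C N)) :=
    { toFun := fun f =>
        { toFun := fun c => CharLeft.of (AddMonoidHom.mk' (fun y : HomRight R C N => e.symm f (y c))
              fun y y' => map_add (e.symm f) (y c) (y' c))
          map_add' := fun c c' => DFunLike.ext _ _ fun y =>
            (congrArg (e.symm f) (map_add y c c')).trans (map_add (e.symm f) (y c) (y c'))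
          map_smul' := fun _ _ => rfl }
      map_add' := fun f f' => DFunLike.ext _ _ fun c => DFunLike.ext _ _ fun y =>
        DFunLike.congr_fun (e.symm.map_add f f') (y c)
      map_smul' := fun r f => DFunLike.ext _ _ fun c => DFunLike.ext _ _ fun y =>
        (DFunLike.congr_fun (e.symm.map_smul r f) (y c)).trans
          (congrArg (e.symm f) (map_smul y (MulOpposite.op r) c).symm) }
  have hφ : ∀ f c (y : HomRight R C N), φ f c y = e.symm f (y c) := fun _ _ _ => rfl
  obtain ⟨θ, hθ⟩ := hC.exists_map_eq hP hX φ
  have hθ' : ∀ f c, θ (f c) = φ f c := fun f c => by rw [hθ]; rfl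
  have hinj : Function.Injective θ := by
    rw [injective_iff_map_eq_zero]
    intro x hx
    obtain ⟨f, rfl⟩ := hC.exists_eq_sum_apply hP hX x
    rw [map_sum] at hx
    simp_rw [hθ'] at hx
    -- The characters `e.symm (f i)` vanish jointly on families `y (g i)`, which are exactly the
    -- solutions of the relations of `C`.
    obtain ⟨ψ, hψ⟩ := exists_character_relations B
      (fun i => (show N →+ AddCircle (1 : ℚ) from e.symm (f i))) fun v hv => by
        obtain ⟨y₀, hy⟩ := hP.exists_linearMap v hv
        let y : HomRight R C N := y₀
        have := DFunLike.congr_fun hx y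
        rw [CharLeft.sum_apply] at this
        simp only [hφ] at this
        refine Eq.trans (Finset.sum_congr rfl fun i _ => ?_) this
        exact congrArg (e.symm (f i)) (hy i).symm
    have hf : ∀ i, f i = ∑ j, (B j i).unop • e (CharLeft.of (ψ j)) := by
      intro i
      have : ∑ j, (B j i).unop • e (CharLeft.of (ψ j)) =
          e (∑ j, (B j i).unop • CharLeft.of (ψ j)) := by
        rw [map_sum]
        exact Finset.sum_congr rfl fun j _ => (e.map_smul _ _).symm
      rw [this, ← LinearEquiv.symm_apply_eq]
      refine DFunLike.ext _ _ fun v => (hψ i v).trans ?_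
      exact (CharLeft.sum_apply Finset.univ (fun j => (B j i).unop • CharLeft.of (ψ j)) v).symm
    simp_rw [hf, HomModule.sum_apply, HomModule.smul_apply, MulOpposite.op_unop]
    rw [Finset.sum_comm]
    simp_rw [← map_sum, hP.rel, map_zero, Finset.sum_const_zero]
  have hsurj : Function.Surjective θ := by
    intro χ
    obtain ⟨ψ, hψ⟩ := exists_character_hom hP (show (C →ₗ[Rᵐᵒᵖ] N) →+ AddCircle (1 : ℚ) from χ)
    refine ⟨∑ i, e (CharLeft.of (ψ i)) (g i), DFunLike.ext _ _ fun y => ?_⟩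
    rw [map_sum, CharLeft.sum_apply]
    simp_rw [hθ', hφ, LinearEquiv.symm_apply_apply]
    exact (hψ y).symm
  let E : X ≃ₗ[R] CharLeft (HomRight R C N) := LinearEquiv.ofBijective θ ⟨hinj, hsurj⟩
  let ev : RTensor R Rᵐᵒᵖ C (HomRight R C N) →ₗ[Rᵐᵒᵖ] N := RTensor.toLinearMap
    (RTensor.lift (AddMonoidHom.mk' (fun c => AddMonoidHom.mk' (fun y : HomRight R C N => y c)
      fun _ _ => rfl) fun c c' => AddMonoidHom.ext fun y => map_add y c c') fun _ _ _ => rfl)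
    fun b c y => map_smul y b c
  have hev : ∀ c (y : HomRight R C N), ev (RTensor.tmul R Rᵐᵒᵖ c y) = y c := fun _ _ => rfl
  refine ⟨ModuleCat.of _ (HomRight R C N), isFpFlatRight_iff_charLeft.2 (hX.of_equiv E),
    ⟨(LinearEquiv.ofBijective ev ⟨?_, ?_⟩).symm⟩⟩
  · rw [injective_iff_map_eq_zero]
    intro t ht
    by_contra hne
    obtain ⟨χ, hχ⟩ := CharLeft.exists_ne_zero hne
    obtain ⟨h, hh⟩ := RTensor.exists_linearMap_of_character
      (show RTensor R Rᵐᵒᵖ C (HomRight R C N) →+ AddCircle (1 : ℚ) from χ)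
    let f : HomModule R C R X := E.symm.toLinearMap ∘ₗ h
    have hf : ∀ c, θ (f c) = h c := fun c => E.apply_symm_apply (h c)
    have key : (show N →+ AddCircle (1 : ℚ) from e.symm f).comp ev.toAddMonoidHom = χ :=
      RTensor.addHom_ext fun c y => by
        refine Eq.trans ?_ (hh c y)
        rw [← hf, hθ']
        rfl
    refine hχ ((DFunLike.congr_fun key t).symm.trans ?_)
    change e.symm f (ev t) = 0
    rw [ht, map_zero]
  · intro v
    by_contra hv
    obtain ⟨χ, hχ, hχv⟩ := exists_character_of_notMem ev.toAddMonoidHom.range (a := v) hv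
    have h0 : e (CharLeft.of χ) = 0 := by
      refine DFunLike.ext _ _ fun c => hinj ?_
      rw [hθ']
      refine DFunLike.ext _ _ fun y => ?_
      rw [hφ, LinearEquiv.symm_apply_apply, HomModule.zero_apply, map_zero]
      exact hχ _ ⟨RTensor.tmul R Rᵐᵒᵖ c y, rfl⟩
    have h1 : (CharLeft.of χ) = 0 := e.injective (h0.trans e.map_zero.symm)
    exact hχv (DFunLike.congr_fun h1 v)

theorem CfpInjective.of_charRight (hC : IsSemidualizing R R C) (hn : 1 ≤ n) {M : Type u}
    [AddCommGroup M] [Module R M] (h : CfpFlatRight R R C n (ModuleCat.of Rᵐᵒᵖ (CharRight M))) :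
    CfpInjective R R C n (ModuleCat.of R M) :=
  h.charLeft.of_isPure hC hn _ (isPure_doubleDual M)

/-- Tensoring with the finitely presented module `C` commutes with products. -/
theorem CfpFlatRight.pi (hC : IsSemidualizing R R C) (hn : 1 ≤ n) {ι : Type u} (N : ι → Type u)
    [∀ i, AddCommGroup (N i)] [∀ i, Module Rᵐᵒᵖ (N i)]
    (h : ∀ i, CfpFlatRight R R C n (ModuleCat.of Rᵐᵒᵖ (N i))) :
    CfpFlatRight R R C n (ModuleCat.of Rᵐᵒᵖ (∀ i, N i)) := by
  obtain ⟨a, b, g, A, hP⟩ :=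
    (hC.resolution_left.finitelyNPresented 1).exists_isPresentation le_rfl
  choose Y hY e using h
  have e i := (e i).some
  let π : RTensor R Rᵐᵒᵖ C (∀ i, Y i) →ₗ[Rᵐᵒᵖ] ∀ i, N i := RTensor.toLinearMap
    (RTensor.lift (AddMonoidHom.mk' (fun c => AddMonoidHom.mk'
        (fun (y : ∀ i, Y i) i => (e i).symm (RTensor.tmul R Rᵐᵒᵖ c (y i)))
        fun y y' => funext fun i => by
          rw [Pi.add_apply, Pi.add_apply, RTensor.tmul_add, map_add])
        fun c c' => AddMonoidHom.ext fun y => funext fun i =>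
          (congrArg (e i).symm (RTensor.add_tmul c c' (y i))).trans ((e i).symm.map_add _ _))
      fun r c y => funext fun i => congrArg (e i).symm (RTensor.smul_tmul r c (y i)))
    fun r c y => funext fun i => (e i).symm.map_smul r (RTensor.tmul R Rᵐᵒᵖ c (y i))
  have hπ : ∀ c y i, π (RTensor.tmul R Rᵐᵒᵖ c y) i = (e i).symm (RTensor.tmul R Rᵐᵒᵖ c (y i)) :=
    fun _ _ _ => rfl
  refine ⟨ModuleCat.of _ (∀ i, Y i), IsFpFlatRight.pi hn _ hY,
    ⟨(LinearEquiv.ofBijective π ⟨?_, ?_⟩).symm⟩⟩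
  · rw [injective_iff_map_eq_zero]
    intro t ht
    obtain ⟨y, rfl⟩ := RTensor.exists_eq_sum hP.span t
    have key : ∀ i, ∑ k, RTensor.tmul R Rᵐᵒᵖ (g k) (y k i) = 0 := by
      intro i
      have := congrFun ht i
      rw [map_sum, Finset.sum_apply] at this
      simp_rw [hπ] at this
      rw [← map_sum] at this
      exact (e i).symm.map_eq_zero_iff.1 this
    choose z hz using fun i => RTensor.exists_of_sum_tmul_eq_zero hP _ (key i)
    have : y = fun k => ∑ j, MulOpposite.op (A j k) • fun i => z i j := by
      ext k i
      rw [hz, Finset.sum_apply]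
      rfl
    rw [this]
    exact RTensor.sum_tmul_relations hP _
  · intro v
    choose y hy using fun i => RTensor.exists_eq_sum (B := Rᵐᵒᵖ) hP.span (e i (v i))
    refine ⟨∑ k, RTensor.tmul R Rᵐᵒᵖ (g k) fun i => y i k, funext fun i => ?_⟩
    rw [map_sum, Finset.sum_apply]
    simp_rw [hπ]
    rw [← map_sum, ← hy, LinearEquiv.symm_apply_apply]

end Duality

/-! ### Cokernels over an `n`-coherent ring. -/

section Coherent

variable {R : Type u} [Ring R] {n : ℕ} {A B E : Type u} [AddCommGroup A] [Module R A]
  [AddCommGroup B] [Module R B] [AddCommGroup E] [Module R E] {i : A →ₗ[R] B} {q : B →ₗ[R] E}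

/-- In effect `Ext¹(P, A) = 0`: a lift from the free cover of `P` is corrected by extending its
restriction to the kernel, which lands in `A`, over the free module. -/
theorem IsFpInjective.exists_lift (hA : IsFpInjective R n A) (hi : Function.Injective i)
    (hiq : Function.Exact i q) (hq : Function.Surjective q) {P : Type u} [AddCommGroup P]
    [Module R P] (hP : FinitelyNPresented R (n + 1) P) (φ : P →ₗ[R] E) :
    ∃ ψ : P →ₗ[R] B, ∀ x, q (ψ x) = φ x := by
  obtain ⟨k, ε, hε, hk⟩ := finitelyNPresented_succ_iff.1 hP
  obtain ⟨l, hl⟩ := Module.projective_lifting_property q (φ ∘ₗ ε) hq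
  have hl : ∀ x, q (l x) = φ (ε x) := LinearMap.congr_fun hl
  obtain ⟨μ, hμ⟩ := exists_comp_linearMap_eq hi (l ∘ₗ (LinearMap.ker ε).subtype) fun x =>
    (hiq _).1 (by
      rw [LinearMap.comp_apply, hl]
      exact (congrArg φ x.2).trans φ.map_zero)
  obtain ⟨ν, hν⟩ := hA _ _ hk (finitelyNPresented_fin n k) _ (Submodule.subtype_injective _) μ
  obtain ⟨ψ, hψ⟩ := exists_linearMap_comp_eq hε (l - i ∘ₗ ν) fun x hx => by
    have h1 : ν x = μ ⟨x, hx⟩ := LinearMap.congr_fun hν ⟨x, hx⟩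
    rw [LinearMap.sub_apply, LinearMap.comp_apply, h1, hμ]
    exact sub_self _
  refine ⟨ψ, fun x => ?_⟩
  obtain ⟨x, rfl⟩ := hε x
  rw [hψ, LinearMap.sub_apply, map_sub, hl, LinearMap.comp_apply, hiq.apply_apply_eq_zero, sub_zero]

/-- `L` is the pushout of `K` and a free cover `R^k` of `L / f(K)` along the kernel of that cover.
Coherence makes this kernel finitely `(n + 1)`-presented, so its map to `E` lifts to `B` and then
extends to `R^k`; this glues with `g`. -/
theorem IsFpInjective.of_exact (hR : IsNCoherent R n) (hA : IsFpInjective R n A)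
    (hB : IsFpInjective R n B) (hi : Function.Injective i)
    (hiq : Function.Exact i q) (hq : Function.Surjective q) : IsFpInjective R n E := by
  intro K L _ _ _ _ hK hL f hf g
  obtain ⟨k, ε, hε, hk⟩ := finitelyNPresented_succ_iff.1 (hR _ (hK.quotient_range hL f hf))
  obtain ⟨l, hl⟩ := Module.projective_lifting_property _ ε (Submodule.mkQ_surjective _)
  have hl : ∀ x, (LinearMap.range f).mkQ (l x) = ε x := LinearMap.congr_fun hl
  obtain ⟨κ, hκ⟩ := exists_comp_linearMap_eq hf (l ∘ₗ (LinearMap.ker ε).subtype) fun x => by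
    rw [← (Submodule.Quotient.mk_eq_zero _)]
    exact (hl x).trans x.2
  obtain ⟨σ, hσ⟩ := hA.exists_lift hi hiq hq (hR _ hk) (g ∘ₗ κ)
  obtain ⟨ρ, hρ⟩ := hB _ _ hk (finitelyNPresented_fin n k) _ (Submodule.subtype_injective _) σ
  have hsurj : Function.Surjective (f.coprod l) := by
    intro x
    obtain ⟨y, hy⟩ := hε (Submodule.Quotient.mk x)
    rw [← hl] at hy
    obtain ⟨z, hz⟩ := (Submodule.Quotient.eq _).1 hy.symm
    exact ⟨(z, y), by rw [LinearMap.coprod_apply, hz, sub_add_cancel]⟩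
  obtain ⟨ω, hω⟩ := exists_linearMap_comp_eq hsurj (g.coprod (q ∘ₗ ρ)) fun x hx => by
    rw [LinearMap.coprod_apply] at hx
    have hx2 : x.2 ∈ LinearMap.ker ε := by
      rw [LinearMap.mem_ker, ← hl, eq_neg_of_add_eq_zero_right hx]
      exact (Submodule.Quotient.mk_eq_zero _).2 (neg_mem ⟨x.1, rfl⟩)
    have h1 : ρ x.2 = σ ⟨x.2, hx2⟩ := LinearMap.congr_fun hρ ⟨x.2, hx2⟩
    have h2 : κ ⟨x.2, hx2⟩ = -x.1 := hf (by
      rw [hκ, map_neg]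
      exact eq_neg_of_add_eq_zero_right hx)
    rw [LinearMap.coprod_apply, LinearMap.comp_apply, h1, hσ, LinearMap.comp_apply, h2, map_neg,
      add_neg_cancel]
  refine ⟨ω, LinearMap.ext fun x => ?_⟩
  have := hω (x, 0)
  simpa using this

/-- Over an `n`-coherent ring, the cokernel of a monomorphism between `C`-`fp_n`-injective modules
is `C`-`fp_n`-injective when `C` is faithfully semidualizing. -/
theorem CfpInjective.of_exact {C : Type u} [AddCommGroup C] [Module R C] [Module Rᵐᵒᵖ C]
    [SMulCommClass R Rᵐᵒᵖ C] (hR : IsNCoherent R n) (hC : IsFaithfullySemidualizing R R C)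
    (hA : CfpInjective R R C n (ModuleCat.of R A)) (hB : CfpInjective R R C n (ModuleCat.of R B))
    (hi : Function.Injective i) (hiq : Function.Exact i q) (hq : Function.Surjective q) :
    CfpInjective R R C n (ModuleCat.of R E) := by
  obtain ⟨U, hU, ⟨α⟩⟩ := hA
  obtain ⟨V, hV, ⟨β⟩⟩ := hB
  obtain ⟨a, b, g, P, hP⟩ :=
    (hC.resolution_right.finitelyNPresented 1).exists_isPresentation le_rfl
  obtain ⟨θ, hθ⟩ := hC.exists_map_eq hP hU (β.toLinearMap ∘ₗ i ∘ₗ α.symm.toLinearMap)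
  have hθ : ∀ f, β (i (α.symm f)) = HomModule.map C θ f := LinearMap.congr_fun hθ
  -- Injectivity of `i` gives `Hom(C, ker θ) = 0`, and faithfulness removes the kernel.
  have hθi : Function.Injective θ := by
    rw [← LinearMap.ker_eq_bot, ← Submodule.subsingleton_iff_eq_bot]
    refine hC.faithful_left _ ⟨fun f f' => ?_⟩
    suffices H : ∀ f : C →ₗ[R] LinearMap.ker θ, f = 0 from (H f).trans (H f').symm
    intro f
    let f₀ : HomModule R C R U := (LinearMap.ker θ).subtype ∘ₗ f
    have h0 : HomModule.map C θ f₀ = 0 := DFunLike.ext _ _ fun c => (f c).2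
    rw [← hθ, LinearEquiv.map_eq_zero_iff, map_eq_zero_iff i hi, LinearEquiv.map_eq_zero_iff] at h0
    exact LinearMap.ext fun c => Subtype.ext (DFunLike.congr_fun h0 c)
  have hex : Function.Exact θ (LinearMap.range θ).mkQ := LinearMap.exact_map_mkQ_range θ
  have hqs := Submodule.mkQ_surjective (LinearMap.range θ)
  have hW := hU.of_exact hR hV hθi hex hqs
  obtain ⟨e, he⟩ := exists_linearMap_comp_eq hq
    (HomModule.map C (LinearMap.range θ).mkQ ∘ₗ β.toLinearMap) fun x hx => by
      obtain ⟨y, rfl⟩ := (hiq x).1 hx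
      have := hθ (α y)
      rw [LinearEquiv.symm_apply_apply] at this
      refine DFunLike.ext _ _ fun c => ?_
      refine (congrArg (fun f => (LinearMap.range θ).mkQ (f c)) this).trans ?_
      exact hex.apply_apply_eq_zero _
  refine ⟨ModuleCat.of R (V ⧸ LinearMap.range θ), hW, ⟨LinearEquiv.ofBijective e ⟨?_, ?_⟩⟩⟩
  · rw [injective_iff_map_eq_zero]
    intro z hz
    obtain ⟨x, rfl⟩ := hq z
    rw [he] at hz
    obtain ⟨f, hf⟩ := exists_comp_linearMap_eq hθi (show C →ₗ[R] V from β x) fun c =>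
      (hex _).1 (DFunLike.congr_fun hz c)
    have h1 : HomModule.map C θ (show HomModule R C R U from f) = β x := DFunLike.ext _ _ hf
    rw [← hθ] at h1
    rw [← β.injective h1, hiq.apply_apply_eq_zero]
  · intro f
    -- Since `C` is finitely `(n + 1)`-presented, `Hom(C, -)` keeps the sequence `0 → U → V → V / U
    -- → 0` exact.
    obtain ⟨ψ, hψ⟩ := hU.exists_lift hθi hex hqs (hC.resolution_left.finitelyNPresented (n + 1))
      (show C →ₗ[R] V ⧸ LinearMap.range θ from f)
    refine ⟨q (β.symm (show HomModule R C R V from ψ)), ?_⟩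
    rw [he]
    refine DFunLike.ext _ _ fun c => Eq.trans ?_ (hψ c)
    rw [LinearMap.comp_apply, LinearEquiv.coe_coe, LinearEquiv.apply_symm_apply]
    rfl

end Coherent

section MapRight

variable {R B K Y Y' : Type*} [Ring R] [Ring B] [AddCommGroup K] [Module R K] [Module B K]
  [SMulCommClass R B K] [AddCommGroup Y] [Module Rᵐᵒᵖ Y] [AddCommGroup Y'] [Module Rᵐᵒᵖ Y']

/-- The homomorphism of tensor products induced by a homomorphism of right modules. -/
noncomputable def RTensor.mapRight (B K : Type*) [Ring B] [AddCommGroup K] [Module R K] [Module B K]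
    [SMulCommClass R B K] (f : Y' →ₗ[Rᵐᵒᵖ] Y) : RTensor R B K Y' →ₗ[B] RTensor R B K Y :=
  RTensor.toLinearMap
    (RTensor.lift (AddMonoidHom.mk' (fun k => (RTensor.tmulLeft B k).comp f.toAddMonoidHom)
      fun k k' => AddMonoidHom.ext fun y => RTensor.add_tmul k k' (f y))
      fun r k y => (RTensor.smul_tmul r k (f y)).trans
        (congrArg (RTensor.tmul R B k) (f.map_smul (MulOpposite.op r) y).symm))
    fun _ _ _ => rfl

@[simp] theorem RTensor.mapRight_tmul (f : Y' →ₗ[Rᵐᵒᵖ] Y) (k : K) (y : Y') :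
    RTensor.mapRight B K f (RTensor.tmul R B k y) = RTensor.tmul R B k (f y) := rfl

end MapRight

/-! ### Pure submodules and tensor products. -/

section PureFlat

variable {R : Type u} [Ring R]

/-- Vanishing in the tensor product with a finitely presented module is solvability of a finite
linear system, which purity reflects. -/
theorem IsPure.mapRight_injective {B K Y Y' : Type*} [Ring B] [AddCommGroup K] [Module R K]
    [Module B K] [SMulCommClass R B K] [AddCommGroup Y] [Module Rᵐᵒᵖ Y] [AddCommGroup Y']
    [Module Rᵐᵒᵖ Y'] {ι : Y' →ₗ[Rᵐᵒᵖ] Y} (h : IsPure ι) {a b : ℕ} {g : Fin a → K}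
    {A : Fin b → Fin a → R} (hP : IsPresentation g A) :
    Function.Injective (RTensor.mapRight B K ι) := by
  rw [injective_iff_map_eq_zero]
  intro t ht
  obtain ⟨y, rfl⟩ := RTensor.exists_eq_sum hP.span t
  simp only [map_sum, RTensor.mapRight_tmul] at ht
  obtain ⟨z, hz⟩ := RTensor.exists_of_sum_tmul_eq_zero hP _ ht
  obtain ⟨z', hz'⟩ := h (Fin a) (Fin b) (fun i j => MulOpposite.op (A j i)) y z
    fun i => (hz i).symm
  simp_rw [← hz']
  exact RTensor.sum_tmul_relations hP z'

theorem IsPure.isFpFlatRight {n : ℕ} (hn : 1 ≤ n) {Y Y' : Type u} [AddCommGroup Y] [Module Rᵐᵒᵖ Y]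
    [AddCommGroup Y'] [Module Rᵐᵒᵖ Y'] {ι : Y' →ₗ[Rᵐᵒᵖ] Y} (h : IsPure ι)
    (hY : IsFpFlatRight R n Y) : IsFpFlatRight R n Y' := by
  intro K L _ _ _ _ hK hL f hf
  obtain ⟨a, b, g, A, hP⟩ := hK.exists_isPresentation hn
  have key : ∀ t : RTensor R ℤ K Y', RTensor.map f Y (RTensor.mapRight ℤ K ι t) =
      RTensor.mapRight ℤ L ι (RTensor.map f Y' t) := by
    intro t
    induction t using RTensor.induction_on with
    | h0 => simp
    | h1 k y => rfl
    | h2 s t hs ht => simp only [map_add, hs, ht]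
  rw [injective_iff_map_eq_zero]
  intro t ht
  refine (injective_iff_map_eq_zero _).1 (h.mapRight_injective (B := ℤ) hP) t ?_
  refine (injective_iff_map_eq_zero _).1 (hY K L hK hL f hf) _ ?_
  rw [key, ht, map_zero]

end PureFlat

/-! ### Pure submodules of bounded size. -/

section SolutionTerm

/-- Terms built from variables by the operations of a module over `A` and by chosen solutions of
finite systems of linear equations. -/
inductive SolutionTerm (A α : Type u) : Type u
  | var : α → SolutionTerm A α
  | zero : SolutionTerm A α
  | add : SolutionTerm A α → SolutionTerm A α → SolutionTerm A α
  | smul : A → SolutionTerm A α → SolutionTerm A α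
  | sol (I J : ℕ) (Q : Fin I → Fin J → A) (v : Fin I → SolutionTerm A α) (j : Fin J) :
      SolutionTerm A α

variable {A α Y : Type u} [Ring A] [AddCommGroup Y] [Module A Y]

open Classical in
/-- The value of a term; the value of the solution of an unsolvable system is zero. -/
noncomputable def SolutionTerm.eval (y : α → Y) : SolutionTerm A α → Y
  | var x => y x
  | zero => 0
  | add s t => s.eval y + t.eval y
  | smul r t => r • t.eval y
  | sol _ J Q v j =>
    if h : ∃ x : Fin J → Y, ∀ i, ∑ j, Q i j • x j = (v i).eval y then h.choose j else 0

/-- The homomorphism to `Y` from the free module on the terms. -/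
noncomputable def SolutionTerm.evalLinearMap (y : α → Y) : (SolutionTerm A α →₀ A) →ₗ[A] Y :=
  Finsupp.linearCombination A (SolutionTerm.eval y)

theorem SolutionTerm.evalLinearMap_single (y : α → Y) (t : SolutionTerm A α) :
    evalLinearMap y (Finsupp.single t 1) = t.eval y := by
  simp [evalLinearMap]

theorem SolutionTerm.exists_eval_eq (y : α → Y) (t : SolutionTerm A α →₀ A) :
    ∃ s : SolutionTerm A α, s.eval y = evalLinearMap y t := by
  induction t using Finsupp.induction_linear with
  | zero => exact ⟨zero, by simp [eval]⟩
  | add s t hs ht =>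
    obtain ⟨s', hs⟩ := hs
    obtain ⟨t', ht⟩ := ht
    exact ⟨add s' t', by rw [eval, hs, ht, map_add]⟩
  | single t r => exact ⟨smul r t, by simp [eval, evalLinearMap]⟩

/-- The homomorphism to `Y` from the free module on the terms modulo its kernel. -/
noncomputable def SolutionTerm.embedding (y : α → Y) :
    ((SolutionTerm A α →₀ A) ⧸ LinearMap.ker (evalLinearMap (A := A) y)) →ₗ[A] Y :=
  (LinearMap.ker (evalLinearMap (A := A) y)).liftQ (evalLinearMap (A := A) y) le_rfl

theorem SolutionTerm.embedding_injective (y : α → Y) :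
    Function.Injective (embedding (A := A) y) := by
  rw [← LinearMap.ker_eq_bot]
  exact Submodule.ker_liftQ_eq_bot _ _ _ le_rfl

theorem SolutionTerm.exists_embedding_eq (y : α → Y) (t : SolutionTerm A α) :
    ∃ z, embedding (A := A) y z = t.eval y :=
  ⟨Submodule.Quotient.mk (Finsupp.single t 1), evalLinearMap_single y t⟩

/-- The terms are closed under solving systems, so their values form a pure submodule containing the
given family. It is a quotient of a free module depending only on `A` and `α`, which bounds its size
independently of `Y`. -/
theorem SolutionTerm.isPure_embedding (y : α → Y) : IsPure (embedding (A := A) y) := by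
  intro I J _ _ Q m x hx
  have hm : ∀ i, ∃ t : SolutionTerm A α, t.eval y = embedding y (m i) := by
    intro i
    obtain ⟨s, hs⟩ := Submodule.Quotient.mk_surjective _ (m i)
    rw [← hs]
    exact exists_eval_eq y s
  choose t ht using hm
  let eI := Fintype.equivFin I
  let eJ := Fintype.equivFin J
  have hsol : ∃ x : Fin (Fintype.card J) → Y, ∀ i,
      ∑ j, Q (eI.symm i) (eJ.symm j) • x j = (t (eI.symm i)).eval y := by
    refine ⟨fun j => x (eJ.symm j), fun i => ?_⟩
    rw [ht, ← hx, ← eJ.symm.sum_comp]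
  choose z hz using fun j => exists_embedding_eq y
    (sol _ _ (fun i j => Q (eI.symm i) (eJ.symm j)) (fun i => t (eI.symm i)) j)
  refine ⟨fun j => z (eJ j), fun i => embedding_injective y ?_⟩
  rw [← ht, map_sum, ← eJ.symm.sum_comp]
  simp only [map_smul, hz, Equiv.apply_symm_apply, eval, dif_pos hsol]
  simpa using hsol.choose_spec (eI i)

end SolutionTerm

/-! ### Existence of preenvelopes. -/

section Preenvelope

variable {R C : Type u} [Ring R] [AddCommGroup C] [Module R C] [Module Rᵐᵒᵖ C]
  [SMulCommClass R Rᵐᵒᵖ C] {n : ℕ}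

/-- The target is the product over all maps from `N` to `Q ⊗ C` with `Q` an `fp_n`-flat quotient of
one fixed free module. A map `N → Y ⊗ C` uses only the elements `y m k` of `Y`; their pure closure
is such a `Q`, and `Q ⊗ C → Y ⊗ C` is injective, so the map factors. -/
theorem exists_isPreenvelope_cfpFlatRight (hC : IsSemidualizing R R C) (hn : 1 ≤ n)
    (N : ModuleCat.{u} Rᵐᵒᵖ) : ∃ (X : ModuleCat.{u} Rᵐᵒᵖ) (f : N ⟶ X),
      IsPreenvelope (CfpFlatRight R R C n) f := by
  obtain ⟨a, b, g, A, hP⟩ :=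
    (hC.resolution_left.finitelyNPresented 1).exists_isPresentation le_rfl
  let T := SolutionTerm Rᵐᵒᵖ (N × Fin a)
  let ι := Σ P : Submodule Rᵐᵒᵖ (T →₀ Rᵐᵒᵖ),
    { _h : N →ₗ[Rᵐᵒᵖ] RTensor R Rᵐᵒᵖ C ((T →₀ Rᵐᵒᵖ) ⧸ P) //
      IsFpFlatRight R n ((T →₀ Rᵐᵒᵖ) ⧸ P) }
  let Z : ι → Type u := fun i => RTensor R Rᵐᵒᵖ C ((T →₀ Rᵐᵒᵖ) ⧸ i.1)
  refine ⟨ModuleCat.of _ (∀ i, Z i), ModuleCat.ofHom (LinearMap.pi fun i => i.2.1),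
    CfpFlatRight.pi hC hn Z fun i =>
      ⟨ModuleCat.of _ ((T →₀ Rᵐᵒᵖ) ⧸ i.1), i.2.2, ⟨LinearEquiv.refl _ _⟩⟩, ?_⟩
  rintro F' ⟨Y, hY, ⟨e⟩⟩ h
  choose y hy using fun m => RTensor.exists_eq_sum (B := Rᵐᵒᵖ) hP.span (e (h m))
  let y' : N × Fin a → Y := fun p => y p.1 p.2
  let θ := SolutionTerm.embedding (A := Rᵐᵒᵖ) y'
  have hθ : IsPure θ := SolutionTerm.isPure_embedding y'
  choose z hz using fun p => SolutionTerm.exists_embedding_eq (A := Rᵐᵒᵖ) y' (SolutionTerm.var p)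
  obtain ⟨h', hh'⟩ := exists_comp_linearMap_eq (hθ.mapRight_injective (B := Rᵐᵒᵖ) hP)
    (e.toLinearMap ∘ₗ h.hom) fun m => by
      refine ⟨∑ k, RTensor.tmul R Rᵐᵒᵖ (g k) (z (m, k)), ?_⟩
      rw [map_sum]
      refine Eq.trans ?_ (hy m).symm
      refine Finset.sum_congr rfl fun k _ => ?_
      exact congrArg (RTensor.tmul R Rᵐᵒᵖ (g k)) (hz (m, k))
  let i : ι := ⟨_, h', hθ.isFpFlatRight hn hY⟩
  refine ⟨ModuleCat.ofHom (e.symm.toLinearMap ∘ₗ RTensor.mapRight Rᵐᵒᵖ C θ ∘ₗ LinearMap.proj i),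
    ?_⟩
  ext m
  exact (congrArg e.symm (hh' m)).trans (e.symm_apply_apply _)

end Preenvelope

section Flip

variable {R M X : Type*} [Ring R] [AddCommGroup M] [Module Rᵐᵒᵖ M] [AddCommGroup X] [Module R X]

/-- The adjoint of a homomorphism to the character module of a right module. -/
def CharLeft.flip (f : X →ₗ[R] CharLeft M) : M →ₗ[Rᵐᵒᵖ] CharRight X where
  toFun m := CharRight.of (AddMonoidHom.mk' (fun x => f x m) fun x x' =>
    DFunLike.congr_fun (f.map_add x x') m)
  map_add' m m' := DFunLike.ext _ _ fun x => map_add (f x) m m'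
  map_smul' r m := DFunLike.ext _ _ fun x => (DFunLike.congr_fun (f.map_smul r.unop x) m).symm

/-- The adjoint of a homomorphism to the character module of a left module. -/
def CharRight.flip (f : M →ₗ[Rᵐᵒᵖ] CharRight X) : X →ₗ[R] CharLeft M where
  toFun x := CharLeft.of (AddMonoidHom.mk' (fun m => f m x) fun m m' =>
    DFunLike.congr_fun (f.map_add m m') x)
  map_add' x x' := DFunLike.ext _ _ fun m => map_add (f m) x x'
  map_smul' r x := DFunLike.ext _ _ fun m =>
    (DFunLike.congr_fun (f.map_smul (MulOpposite.op r) m) x).symm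

end Flip

/-! ### The implications between the assertions. -/

section Main

variable {R C : Type u} [Ring R] [AddCommGroup C] [Module R C] [Module Rᵐᵒᵖ C] {n : ℕ}

theorem ClosedUnderSubmodules.of_injective
    (h : ClosedUnderSubmodules (CfpFlatRight R R C n)) {M N : Type u} [AddCommGroup M]
    [Module Rᵐᵒᵖ M] [AddCommGroup N] [Module Rᵐᵒᵖ N]
    (hN : CfpFlatRight R R C n (ModuleCat.of Rᵐᵒᵖ N)) (f : M →ₗ[Rᵐᵒᵖ] N)
    (hf : Function.Injective f) : CfpFlatRight R R C n (ModuleCat.of Rᵐᵒᵖ M) :=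
  CfpFlatRight.of_equiv (h _ hN (LinearMap.range f)) (LinearEquiv.ofInjective f hf).symm

theorem HasEpicEnvelopes.closedUnderSubmodules (h : HasEpicEnvelopes (CfpFlatRight R R C n)) :
    ClosedUnderSubmodules (CfpFlatRight R R C n) := by
  intro M hM N
  obtain ⟨X, f, hf, hepi⟩ := h (ModuleCat.of Rᵐᵒᵖ N)
  obtain ⟨k, hk⟩ := hf.extend M hM (ModuleCat.ofHom N.subtype)
  refine CfpFlatRight.of_equiv (M := X) hf.mem (LinearEquiv.ofBijective f.hom
    ⟨fun x y hxy => Subtype.ext ?_, (ModuleCat.epi_iff_surjective f).1 hepi⟩).symm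
  have hk' : ∀ x, k (f x) = x.1 := fun x => congrArg (fun l => l.hom x) hk
  rw [← hk', ← hk']
  exact congrArg k hxy

variable [SMulCommClass R Rᵐᵒᵖ C]

theorem ClosedUnderQuotients.of_surjective
    (h : ClosedUnderQuotients (CfpInjective R R C n)) {M N : Type u} [AddCommGroup M] [Module R M]
    [AddCommGroup N] [Module R N] (hM : CfpInjective R R C n (ModuleCat.of R M)) (f : M →ₗ[R] N)
    (hf : Function.Surjective f) : CfpInjective R R C n (ModuleCat.of R N) :=
  CfpInjective.of_equiv (h _ hM (LinearMap.ker f)) (f.quotKerEquivOfSurjective hf)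

theorem HasMonicCovers.closedUnderQuotients (h : HasMonicCovers (CfpInjective R R C n)) :
    ClosedUnderQuotients (CfpInjective R R C n) := by
  intro M hM N
  obtain ⟨X, f, hf, hmono⟩ := h (ModuleCat.of R (M ⧸ N))
  obtain ⟨k, hk⟩ := hf.lift M hM (ModuleCat.ofHom N.mkQ)
  refine CfpInjective.of_equiv (M := X) hf.mem (LinearEquiv.ofBijective f.hom
    ⟨(ModuleCat.mono_iff_injective f).1 hmono, fun x => ?_⟩)
  obtain ⟨m, rfl⟩ := N.mkQ_surjective x
  exact ⟨k m, congrArg (fun l => l.hom m) hk⟩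

/-- The sum of all submodules in the class is a quotient of their direct sum, hence in the class,
and it contains the image of every map from a member. -/
theorem ClosedUnderQuotients.hasMonicCovers (hC : IsSemidualizing R R C) (hn : 1 ≤ n)
    (h : ClosedUnderQuotients (CfpInjective R R C n)) :
    HasMonicCovers (CfpInjective R R C n) := by
  classical
  intro M
  let ι := { N : Submodule R M // CfpInjective R R C n (ModuleCat.of R N) }
  let T : Submodule R M := ⨆ N : ι, N.1
  have hT : CfpInjective R R C n (ModuleCat.of R T) := by
    let p : (Π₀ N : ι, N.1) →ₗ[R] M := DFinsupp.lsum ℕ fun N => N.1.subtype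
    have hp : T = LinearMap.range p := Submodule.iSup_eq_range_dfinsupp_lsum _
    rw [hp]
    exact h.of_surjective (CfpInjective.dfinsupp hC hn (fun N : ι => N.1) fun N => N.2)
      p.rangeRestrict p.surjective_rangeRestrict
  have hmono : Mono (ModuleCat.ofHom T.subtype) :=
    (ModuleCat.mono_iff_injective _).2 T.subtype_injective
  refine ⟨ModuleCat.of R T, ModuleCat.ofHom T.subtype, ⟨⟨hT, fun X' hX' g => ?_⟩, fun g hg => ?_⟩,
    hmono⟩
  · have hg : LinearMap.range g.hom ≤ T := le_iSup (fun N : ι => N.1)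
      ⟨LinearMap.range g.hom, h.of_surjective (M := X') hX' g.hom.rangeRestrict
        g.hom.surjective_rangeRestrict⟩
    exact ⟨ModuleCat.ofHom (g.hom.codRestrict T fun x => hg ⟨x, rfl⟩), rfl⟩
  · have : g = 𝟙 _ := (cancel_mono (ModuleCat.ofHom T.subtype)).1 (by rw [hg, Category.id_comp])
    rw [this]
    infer_instance

theorem ClosedUnderSubmodules.hasEpicEnvelopes (hC : IsSemidualizing R R C) (hn : 1 ≤ n)
    (h : ClosedUnderSubmodules (CfpFlatRight R R C n)) :
    HasEpicEnvelopes (CfpFlatRight R R C n) := by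
  intro N
  obtain ⟨P, φ, hP, hφ⟩ : ∃ (P : ModuleCat.{u} Rᵐᵒᵖ) (φ : N →ₗ[Rᵐᵒᵖ] P),
      CfpFlatRight R R C n P ∧ ∀ K : Submodule Rᵐᵒᵖ N,
        CfpFlatRight R R C n (ModuleCat.of Rᵐᵒᵖ (N ⧸ K)) → ∀ x, φ x = 0 → x ∈ K := by
    let ι := { K : Submodule Rᵐᵒᵖ N // CfpFlatRight R R C n (ModuleCat.of Rᵐᵒᵖ (N ⧸ K)) }
    refine ⟨ModuleCat.of Rᵐᵒᵖ (∀ K : ι, N ⧸ K.1), LinearMap.pi fun K => K.1.mkQ,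
      CfpFlatRight.pi hC hn _ fun K : ι => K.2, fun K hK x hx => ?_⟩
    exact (Submodule.Quotient.mk_eq_zero _).1 (congrFun hx (⟨K, hK⟩ : ι))
  have hX : CfpFlatRight R R C n (ModuleCat.of Rᵐᵒᵖ (LinearMap.range φ)) :=
    h _ hP _
  let f : N ⟶ ModuleCat.of Rᵐᵒᵖ (LinearMap.range φ) := ModuleCat.ofHom φ.rangeRestrict
  have hepi : Epi f := (ModuleCat.epi_iff_surjective f).2 φ.surjective_rangeRestrict
  refine ⟨ModuleCat.of _ (LinearMap.range φ), f,
    ⟨⟨hX, fun X' hX' g => ?_⟩, fun g hg => ?_⟩, hepi⟩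
  -- `N / ker g` embeds in `X'`, so it is one of the factors, and `ker φ ≤ ker g`.
  · have hK := h.of_injective (N := X') hX' ((LinearMap.ker g.hom).liftQ g.hom le_rfl) (by
      rw [← LinearMap.ker_eq_bot]
      exact Submodule.ker_liftQ_eq_bot _ _ _ le_rfl)
    obtain ⟨θ, hθ⟩ := exists_linearMap_comp_eq φ.surjective_rangeRestrict g.hom fun x hx =>
      hφ _ hK x (congrArg Subtype.val hx)
    exact ⟨ModuleCat.ofHom θ, ModuleCat.hom_ext (LinearMap.ext hθ)⟩
  · have : g = 𝟙 _ := (cancel_epi f).1 (by rw [hg, Category.comp_id])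
    rw [this]
    infer_instance

theorem ClosedUnderQuotients.closedUnderSubmodules (hC : IsSemidualizing R R C)
    (h : ClosedUnderQuotients (CfpInjective R R C n)) :
    ClosedUnderSubmodules (CfpFlatRight R R C n) := fun M hM N =>
  CfpFlatRight.of_charLeft hC (h.of_surjective (CfpFlatRight.charLeft (N := M) hM)
    (CharLeft.map N.subtype) (CharLeft.map_surjective N.subtype_injective))

theorem ClosedUnderSubmodules.closedUnderQuotients (hC : IsSemidualizing R R C) (hn : 1 ≤ n)
    (h : ClosedUnderSubmodules (CfpFlatRight R R C n)) :
    ClosedUnderQuotients (CfpInjective R R C n) := fun M hM N =>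
  CfpInjective.of_charRight hC hn (h.of_injective (CfpInjective.charRight (M := M) hC hn hM)
    (CharRight.map N.mkQ) (CharRight.map_injective N.mkQ_surjective))

/-- The image of `f` is in the class, so its inclusion lifts to a section `s`; then `id - s f` maps
`X` onto the kernel. -/
theorem ClosedUnderQuotients.kernelsOfPrecoversMem
    (h : ClosedUnderQuotients (CfpInjective R R C n)) :
    KernelsOfPrecoversMem (CfpInjective R R C n) := by
  intro M X f hf
  obtain ⟨s, hs⟩ := hf.lift _ (h.of_surjective (M := X) hf.mem f.hom.rangeRestrict
    f.hom.surjective_rangeRestrict) (ModuleCat.ofHom (LinearMap.range f.hom).subtype)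
  have hs : ∀ x, f.hom (s.hom x) = x.1 := fun x => congrArg (fun l => l.hom x) hs
  refine h.of_surjective (M := X) hf.mem
    ((LinearMap.id - s.hom ∘ₗ f.hom.rangeRestrict).codRestrict (LinearMap.ker f.hom) fun x => ?_)
    fun x => ⟨x, Subtype.ext ?_⟩
  · have h0 : f.hom.rangeRestrict x.1 = 0 := Subtype.ext x.2
    change x.1 - s.hom (f.hom.rangeRestrict x.1) = x.1
    rw [h0, map_zero, sub_zero]
  · rw [LinearMap.mem_ker, LinearMap.sub_apply, map_sub, LinearMap.comp_apply, hs]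
    exact sub_self _

/-- The dual of a preenvelope is a precover, since maps `X' → M⁺` correspond to maps `M → X'⁺`; its
kernel is the character module of the cokernel. -/
theorem KernelsOfPrecoversMem.cokernelsOfPreenvelopesMem (hC : IsSemidualizing R R C) (hn : 1 ≤ n)
    (h : KernelsOfPrecoversMem (CfpInjective R R C n)) :
    CokernelsOfPreenvelopesMem (CfpFlatRight R R C n) := by
  intro M X f hf
  have hpre : IsPrecover (CfpInjective R R C n) (ModuleCat.ofHom (CharLeft.map (R := R) f.hom)) := by
    refine ⟨CfpFlatRight.charLeft (N := X) hf.mem, fun X' hX' g => ?_⟩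
    obtain ⟨k, hk⟩ := hf.extend _ (CfpInjective.charRight (M := X') hC hn hX')
      (ModuleCat.ofHom (CharLeft.flip g.hom))
    refine ⟨ModuleCat.ofHom (CharRight.flip k.hom), ModuleCat.hom_ext (LinearMap.ext fun x =>
      DFunLike.ext _ _ fun m => ?_)⟩
    exact congrArg (fun l => (l.hom m : CharRight X') x) hk
  have hex := CharLeft.exact_map (LinearMap.exact_map_mkQ_range f.hom)
  let E : CharLeft (X ⧸ LinearMap.range f.hom) →ₗ[R] LinearMap.ker (CharLeft.map (R := R) f.hom) :=
    (CharLeft.map (LinearMap.range f.hom).mkQ).codRestrict _ hex.apply_apply_eq_zero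
  have hE : Function.Bijective E := by
    refine ⟨fun x y hxy => ?_, fun x => ?_⟩
    · exact CharLeft.map_injective (Submodule.mkQ_surjective _) (congrArg Subtype.val hxy)
    · obtain ⟨y, hy⟩ := (hex _).1 x.2
      exact ⟨y, Subtype.ext hy⟩
  exact CfpFlatRight.of_charLeft hC
    (CfpInjective.of_equiv (h _ _ _ hpre) (LinearEquiv.ofBijective E hE).symm)

/-- The inclusion of `N` in a member factors through any preenvelope of `N`, which is therefore
monic; its dual sequence then puts `N⁺` in `Cfp_nI(R)`. -/
theorem CokernelsOfPreenvelopesMem.closedUnderSubmodules (hR : IsNCoherent R n)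
    (hC : IsFaithfullySemidualizing R R C) (hn : 1 ≤ n)
    (h : CokernelsOfPreenvelopesMem (CfpFlatRight R R C n)) :
    ClosedUnderSubmodules (CfpFlatRight R R C n) := by
  intro M hM N
  obtain ⟨X, f, hf⟩ :=
    exists_isPreenvelope_cfpFlatRight hC.toIsSemidualizing hn (ModuleCat.of Rᵐᵒᵖ N)
  obtain ⟨k, hk⟩ := hf.extend M hM (ModuleCat.ofHom N.subtype)
  have hk' : ∀ x, k (f x) = x.1 := fun x => congrArg (fun l => l.hom x) hk
  have hfi : Function.Injective f.hom := fun x y hxy => Subtype.ext (by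
    rw [← hk', ← hk']
    exact congrArg k hxy)
  exact CfpFlatRight.of_charLeft hC.toIsSemidualizing (CfpInjective.of_exact hR hC
    (CfpFlatRight.charLeft (h _ _ f hf)) (CfpFlatRight.charLeft (N := X) hf.mem)
    (CharLeft.map_injective (Submodule.mkQ_surjective _))
    (CharLeft.exact_map (LinearMap.exact_map_mkQ_range f.hom)) (CharLeft.map_surjective hfi))

end Main

end CfpModules

theorem corollary3p14 (R : Type u) [Ring R] (C : Type u) [AddCommGroup C] [Module R C]
    [Module Rᵐᵒᵖ C] [SMulCommClass R Rᵐᵒᵖ C] (hC : CfpModules.IsSemidualizing R R C)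
    (n : ℕ) (hn : 1 ≤ n) :
    List.TFAE
      [CfpModules.HasMonicCovers (CfpModules.CfpInjective R R C n),
       CfpModules.HasEpicEnvelopes (CfpModules.CfpFlatRight R R C n),
       CfpModules.ClosedUnderQuotients (CfpModules.CfpInjective R R C n),
       CfpModules.ClosedUnderSubmodules (CfpModules.CfpFlatRight R R C n)] ∧
    (CfpModules.IsNCoherent R n → CfpModules.IsFaithfullySemidualizing R R C →
      List.TFAE
        [CfpModules.HasMonicCovers (CfpModules.CfpInjective R R C n),
         CfpModules.HasEpicEnvelopes (CfpModules.CfpFlatRight R R C n),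
         CfpModules.ClosedUnderQuotients (CfpModules.CfpInjective R R C n),
         CfpModules.ClosedUnderSubmodules (CfpModules.CfpFlatRight R R C n),
         CfpModules.KernelsOfPrecoversMem (CfpModules.CfpInjective R R C n),
         CfpModules.CokernelsOfPreenvelopesMem (CfpModules.CfpFlatRight R R C n)]) := by
  have h13 : CfpModules.HasMonicCovers (CfpModules.CfpInjective R R C n) ↔
      CfpModules.ClosedUnderQuotients (CfpModules.CfpInjective R R C n) :=
    ⟨fun h => h.closedUnderQuotients, fun h => h.hasMonicCovers hC hn⟩
  have h24 : CfpModules.HasEpicEnvelopes (CfpModules.CfpFlatRight R R C n) ↔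
      CfpModules.ClosedUnderSubmodules (CfpModules.CfpFlatRight R R C n) :=
    ⟨fun h => h.closedUnderSubmodules, fun h => h.hasEpicEnvelopes hC hn⟩
  have h34 : CfpModules.ClosedUnderQuotients (CfpModules.CfpInjective R R C n) ↔
      CfpModules.ClosedUnderSubmodules (CfpModules.CfpFlatRight R R C n) :=
    ⟨fun h => h.closedUnderSubmodules hC, fun h => h.closedUnderQuotients hC hn⟩
  refine ⟨?_, fun hR hF => ?_⟩
  · tfae_have 1 ↔ 3 := h13
    tfae_have 2 ↔ 4 := h24
    tfae_have 3 ↔ 4 := h34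
    tfae_finish
  · tfae_have 1 ↔ 3 := h13
    tfae_have 2 ↔ 4 := h24
    tfae_have 3 ↔ 4 := h34
    tfae_have 3 → 5 := fun h => h.kernelsOfPrecoversMem
    tfae_have 5 → 6 := fun h => h.cokernelsOfPreenvelopesMem hC hn
    tfae_have 6 → 4 := fun h => h.closedUnderSubmodules hR hF hn
    tfae_finish
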